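/- **Theorem.** Let $n\ge 2$, let $\mathbb S^{n-1}=\{x\in\mathbb R^n:|x|=1\}$, and let $\sigma_{n-1}$ be the uniform (normalized surface) probability measure on $\mathbb S^{n-1}$. For a continuously differentiable function $f:\mathbb S^{n-1}\to\mathbb R$, the spherical gradient $\nabla_{\mathbb S}f(x)$ is the shortest vector $w\in\mathbb R^n$ with $f(x')=f(x)+\langle w,x'-x\rangle+o(|x'-x|)$ as $x'\to x$, $x'\in\mathbb S^{n-1}$. Write $\mathrm{cov}_{\sigma_{n-1}}(f,g)=\int fg\,d\sigma_{n-1}-\int f\,d\sigma_{n-1}\int g\,d\sigma_{n-1}$. For $|\alpha|\le 1$ put $$\psi_n(\alpha)=\frac{1}{2^{n-2}\,\Gamma(\frac n2)^2}\int_0^1(1-t^2)^{\frac{n-2}{2}}\left[\int_0^\infty\!\!\int_0^\infty \exp\Big(-\frac{r^2+r'^2-2rr't\alpha}{2}\Big)(rr')^{n-2}\,dr\,dr'\right]dt\in[0,\infty],$$ and let $\nu_n$ be the measure on $\mathbb S^{n-1}\times\mathbb S^{n-1}$ with density $\psi_n(\langle x,y\rangle)$ with respect to $\sigma_{n-1}\otimes\sigma_{n-1}$.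 Then: 1. $\psi_n(\alpha)>0$ for $-1\le\alpha\le 1$ and $\psi_n(\alpha)<\infty$ for $-1\le\alpha<1$; if $n=2$, then $\psi_2(\alpha)\le 2\pi$ for all $-1\le\alpha\le1$. 2. For all continuously differentiable $f,g:\mathbb S^{n-1}\to\mathbb R$, the function $(x,y)\mapsto\langle\nabla_{\mathbb S}f(x),\nabla_{\mathbb S}g(y)\rangle$ is $\nu_n$-integrable and $$\mathrm{cov}_{\sigma_{n-1}}(f,g)=\int_{\mathbb S^{n-1}\times\mathbb S^{n-1}}\langle\nabla_{\mathbb S}f(x),\nabla_{\mathbb S}g(y)\rangle\,d\nu_n(x,y).$$ 3. $\nu_n=c_n\mu_n$ for a constant $c_n\in(0,\infty)$ and a probability measure $\mu_n$ on $\mathbb S^{n-1}\times\mathbb S^{n-1}$ both of whose marginals are $\sigma_{n-1}$. If $n\ge 3$, then $\frac1{n-1}<c_n<\frac1{n-2}$; if $n=2$, then $c_2<\pi$. -/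

import Mathlib

open MeasureTheory ProbabilityTheory Topology Asymptotics
open scoped Manifold ContDiff RealInnerProductSpace ENNReal

noncomputable section

namespace SphereCov

/-- The Euclidean space `ℝⁿ`. -/
abbrev Space (n : ℕ) : Type := EuclideanSpace ℝ (Fin n)

/-- The unit sphere `S^{n-1}` of `ℝⁿ`. -/
abbrev Sph (n : ℕ) : Type := Metric.sphere (0 : Space n) 1

/-- The uniform distribution `σ_{n-1}`: the surface measure on `S^{n-1}`, normalized to total
mass one. -/
def sigma (n : ℕ) : Measure (Sph n) :=
  ((volume : Measure (Space n)).toSphere Set.univ)⁻¹ • (volume : Measure (Space n)).toSphere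

/-- `f` is continuously differentiable on the manifold `S^{n-1}` (of dimension `n - 1`). The
`Fact` only provides the manifold structure of the sphere; it holds as soon as `1 ≤ n`. -/
def IsC1 {n : ℕ} (f : Sph n → ℝ) : Prop :=
  ∃ _ : Fact (Module.finrank ℝ (Space n) = (n - 1) + 1), ContMDiff (𝓡 (n - 1)) 𝓘(ℝ, ℝ) 1 f

/-- `w ∈ ℝⁿ` satisfies `f(x') = f(x) + ⟨w, x' - x⟩ + o(|x' - x|)` as `x' → x` on the sphere. -/
def IsTaylorVector {n : ℕ} (f : Sph n → ℝ) (x : Sph n) (w : Space n) : Prop :=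
  (fun x' : Sph n => f x' - f x - ⟪w, (x' : Space n) - (x : Space n)⟫)
    =o[𝓝 x] (fun x' : Sph n => (x' : Space n) - (x : Space n))

/-- `w` is the shortest vector satisfying the first order Taylor expansion of `f` at `x`. -/
def IsSphericalGradient {n : ℕ} (f : Sph n → ℝ) (x : Sph n) (w : Space n) : Prop :=
  IsTaylorVector f x w ∧ ∀ w' : Space n, IsTaylorVector f x w' → ‖w‖ ≤ ‖w'‖

/-- The spherical gradient `∇_S f(x)`. For continuously differentiable `f` it is the unique vector
with `IsSphericalGradient f x`, see `existsUnique_isSphericalGradient`. -/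
def sphericalGradient {n : ℕ} (f : Sph n → ℝ) (x : Sph n) : Space n :=
  Classical.epsilon (IsSphericalGradient f x)

/-- The function `ψ_n`, with values in `[0, ∞]`:
`ψ_n(α) = (2^{n-2} Γ(n/2)²)⁻¹ ∫₀¹ s^{n-2} ∫₀^∞ ∫₀^∞ exp(-(r² + r'² - 2 r r' t α)/2)
(r r')^{n-2} dr dr' dt`, where `s = √(1 - t²)`. -/
def psi (n : ℕ) (α : ℝ) : ℝ≥0∞ :=
  ENNReal.ofReal (1 / (2 ^ (n - 2) * Real.Gamma ((n : ℝ) / 2) ^ 2)) *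
    ∫⁻ t in Set.Ioo (0 : ℝ) 1, ENNReal.ofReal (Real.sqrt (1 - t ^ 2) ^ (n - 2)) *
      ∫⁻ r in Set.Ioi (0 : ℝ), ∫⁻ r' in Set.Ioi (0 : ℝ),
        ENNReal.ofReal
          (Real.exp (-(r ^ 2 + r' ^ 2 - 2 * r * r' * t * α) / 2) * (r * r') ^ (n - 2))

/-- The measure `ν_n` on `S^{n-1} × S^{n-1}` with density `ψ_n(⟨x, y⟩)` with respect to
`σ_{n-1} ⊗ σ_{n-1}`. -/
def nu (n : ℕ) : Measure (Sph n × Sph n) :=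
  ((sigma n).prod (sigma n)).withDensity
    (fun p => psi n ⟪(p.1 : Space n), (p.2 : Space n)⟫)

/-! Well-definedness of the spherical gradient. -/

theorem exists_isTaylorVector {n : ℕ} {f : Sph n → ℝ} (hf : IsC1 f) (x : Sph n) :
    ∃ w, IsTaylorVector f x w := by
  obtain ⟨hF, hf⟩ := hf
  have hx : (x : Space n) ≠ 0 := ne_zero_of_mem_unit_sphere x
  classical
  let g : Space n → Sph n := fun y =>
    if h : y = 0 then x else ⟨‖y‖⁻¹ • y, by simp [norm_smul, h]⟩
  have hgx : ∀ x' : Sph n, g x' = x' := by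
    intro x'
    have h0 : (x' : Space n) ≠ 0 := ne_zero_of_mem_unit_sphere x'
    simp [g, h0]
  let U : TopologicalSpace.Opens (Space n) := ⟨{y | y ≠ 0}, isOpen_ne⟩
  have hg : ContMDiff 𝓘(ℝ, Space n) (𝓡 (n - 1)) 1 (fun y : U => g y) := by
    have h2 : ContMDiff 𝓘(ℝ, Space n) 𝓘(ℝ, Space n) 1
        (fun y : U => ‖(y : Space n)‖⁻¹ • (y : Space n)) := by
      intro y
      refine contMDiffAt_subtype_iff (f := fun y : Space n => ‖y‖⁻¹ • y).2 ?_
      rw [contMDiffAt_iff_contDiffAt]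
      exact ((contDiffAt_norm ℝ y.2).inv (norm_ne_zero_iff.2 y.2)).smul contDiffAt_id
    have h3 : ∀ y : U, ‖(y : Space n)‖⁻¹ • (y : Space n) ∈ Metric.sphere (0 : Space n) 1 := by
      intro y
      have hy : (y : Space n) ≠ 0 := y.2
      simp [norm_smul, hy]
    have h4 := h2.codRestrict_sphere (n := n - 1) h3
    refine h4.congr fun y => ?_
    have hy : (y : Space n) ≠ 0 := y.2
    ext1
    simp [g, hy]
  have hd : DifferentiableAt ℝ (fun y => f (g y)) (x : Space n) := by
    have h3 : ContMDiffAt 𝓘(ℝ, Space n) 𝓘(ℝ, ℝ) 1 (fun y => f (g y)) (x : Space n) :=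
      contMDiffAt_subtype_iff (x := (⟨x, hx⟩ : U)).1 ((hf.comp hg) ⟨x, hx⟩)
    exact (contMDiffAt_iff_contDiffAt.1 h3).differentiableAt (by simp)
  refine ⟨gradient (fun y => f (g y)) (x : Space n), ?_⟩
  have h4 := (hasGradientAt_iff_isLittleO.1 hd.hasGradientAt).comp_tendsto
    (continuous_subtype_val.tendsto x)
  simpa [IsTaylorVector, Function.comp_def, hgx] using h4

theorem existsUnique_isSphericalGradient {n : ℕ} {f : Sph n → ℝ} (hf : IsC1 f) (x : Sph n) :
    ∃! w, IsSphericalGradient f x w := by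
  obtain ⟨w₀, h₀⟩ := exists_isTaylorVector hf x
  let N : Submodule ℝ (Space n) :=
    { carrier := {v | (fun x' : Sph n => ⟪v, (x' : Space n) - (x : Space n)⟫)
          =o[𝓝 x] (fun x' : Sph n => (x' : Space n) - (x : Space n))}
      add_mem' := by
        intro a b ha hb
        simpa [inner_add_left] using IsLittleO.add ha hb
      zero_mem' := by simp
      smul_mem' := by
        intro c a ha
        simpa [inner_smul_left] using IsLittleO.const_mul_left ha c }
  have hN : ∀ a b : Space n, IsTaylorVector f x a → (IsTaylorVector f x b ↔ b - a ∈ N) := by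
    intro a b ha
    constructor
    · intro hb
      refine (IsLittleO.sub ha hb).congr_left fun x' => ?_
      rw [inner_sub_left]
      ring
    · intro hb
      refine (IsLittleO.sub ha hb).congr_left fun x' => ?_
      rw [inner_sub_left]
      ring
  obtain ⟨p, hp, q, hq, hpq⟩ := N.exists_add_mem_mem_orthogonal w₀
  have hqT : IsTaylorVector f x q := by
    rw [hN w₀ q h₀, hpq]
    simpa using N.neg_mem hp
  have key : ∀ w', IsTaylorVector f x w' → ‖w'‖ * ‖w'‖ = ‖q‖ * ‖q‖ + ‖w' - q‖ * ‖w' - q‖ := by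
    intro w' hw'
    have h1 : w' - q ∈ N := (hN q w' hqT).1 hw'
    have h2 : ⟪q, w' - q⟫ = 0 := by
      rw [real_inner_comm]
      exact hq _ h1
    rw [← norm_add_sq_eq_norm_sq_add_norm_sq_real h2]
    simp
  refine ⟨q, ⟨hqT, fun w' hw' => ?_⟩, fun w hw => ?_⟩
  · exact abs_le_of_sq_le_sq' (by nlinarith [key w' hw', norm_nonneg (w' - q)])
      (norm_nonneg _) |>.2
  · have h1 := key w hw.1
    have h2 := hw.2 q hqT
    have h3 : ‖w - q‖ * ‖w - q‖ ≤ 0 := by nlinarith [norm_nonneg w, norm_nonneg q]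
    have h4 : ‖w - q‖ = 0 := by nlinarith [norm_nonneg (w - q)]
    exact sub_eq_zero.1 (norm_eq_zero.1 h4)

theorem isSphericalGradient_sphericalGradient {n : ℕ} {f : Sph n → ℝ} (hf : IsC1 f) (x : Sph n) :
    IsSphericalGradient f x (sphericalGradient f x) :=
  Classical.epsilon_spec (existsUnique_isSphericalGradient hf x).exists

end SphereCov

end

/-! Everything comes from the Gaussian covariance representation (`gaussian_covariance`). For
independent standard Gaussian vectors `X`, `Z` and `Y_t = tX + √(1 - t²)Z`, the covariance of `F(X)`
and `G(X)` is the integral over `t ∈ (0, 1)` of `E⟨∇F(X), ∇G(Y_t)⟩`. Take for `F` and `G` the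
extensions of `f` and `g` that are homogeneous of degree zero. The direction of `X` is uniform
(`map_radial_stdGaussian`), so the left side is the covariance on the sphere. As `∇F(x) = |x|⁻¹ ∇_S
f(x/|x|)` (`gradient_comp_radial`), the right side integrates `⟨∇_S f, ∇_S g⟩` at the directions of
`X` and `Y_t` with weight `|X|⁻¹|Y_t|⁻¹`. Polar coordinates in both vectors show that the weighted
law of these directions is exactly `ν_n` (`lintegral_correlated_radial`, `lintegral_nu`).

The extensions are singular at the origin. They are smoothed there, rescaled
(`exists_regularization`), and the limit is taken by dominated convergence, the weight being
integrable because `ν_n` is finite. For `n ≥ 3` finiteness follows from that of `E|X|⁻²`; for `n =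
2` it follows from `ψ₂(α) + ψ₂(-α) ≤ π²/2`, which also gives `ψ₂ ≤ 2π` and `c₂ ≤ π²/4 < π`.

Rotation invariance makes the marginals uniform. For `n ≥ 3`, summing the representation over the
coordinate functions gives `(n - 2)c_n + ∫⟨x, y⟩² dν_n = 1` (`mass_mul_add_integral`); the integral
lies strictly between `0` and `c_n`, whence both bounds. -/

noncomputable section

namespace SphereCov

/-! ### Density, rotation invariance and integration by parts for the standard Gaussian measure. -/

section Gaussian

variable {E : Type*} [NormedAddCommGroup E] [InnerProductSpace ℝ E]

/-- The density of the standard Gaussian measure with respect to Lebesgue measure. -/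
def gaussianDensity (E : Type*) [NormedAddCommGroup E] [InnerProductSpace ℝ E] (x : E) : ℝ :=
  ((2 * Real.pi) ^ (Module.finrank ℝ E / 2 : ℝ))⁻¹ * Real.exp (-‖x‖ ^ 2 / 2)

lemma gaussianDensity_pos (x : E) : 0 < gaussianDensity E x := by
  unfold gaussianDensity
  positivity

lemma continuous_gaussianDensity : Continuous (gaussianDensity E) := by
  unfold gaussianDensity
  fun_prop

variable [FiniteDimensional ℝ E] [MeasurableSpace E] [BorelSpace E]

lemma integrable_gaussianDensity : Integrable (gaussianDensity E) := by
  have h := GaussianFourier.integrable_cexp_neg_mul_sq_norm_add (V := E) (b := 1 / 2) (by simp) 0 0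
  have h2 := h.norm.const_mul ((2 * Real.pi) ^ (Module.finrank ℝ E / 2 : ℝ))⁻¹
  refine h2.congr (Filter.Eventually.of_forall fun x => ?_)
  have h3 : -(1 / 2 : ℂ) * (‖x‖ : ℂ) ^ 2 + 0 * ((⟪0, x⟫ : ℝ) : ℂ) = ((-‖x‖ ^ 2 / 2 : ℝ) : ℂ) := by
    push_cast
    ring
  simp only [gaussianDensity, Complex.norm_exp, h3, Complex.ofReal_re]

/-- The standard Gaussian measure has density `gaussianDensity`. -/
lemma stdGaussian_eq_withDensity :
    stdGaussian E = volume.withDensity fun x => ENNReal.ofReal (gaussianDensity E x) := by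
  have hfin : IsFiniteMeasure
      ((volume : Measure E).withDensity fun x => ENNReal.ofReal (gaussianDensity E x)) :=
    isFiniteMeasure_withDensity_ofReal integrable_gaussianDensity.2
  refine Measure.ext_of_charFun ?_
  ext t
  rw [charFun_stdGaussian, charFun_apply, integral_withDensity_eq_integral_toReal_smul
    (by exact (continuous_gaussianDensity.measurable).ennreal_ofReal) (by simp)]
  have h := GaussianFourier.integral_cexp_neg_mul_sq_norm_add (V := E) (b := 1 / 2) (by simp)
    Complex.I t
  have h2 : ∀ x : E, (ENNReal.ofReal (gaussianDensity E x)).toReal •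
      Complex.exp (((⟪x, t⟫ : ℝ) : ℂ) * Complex.I) =
      ((((2 * Real.pi) ^ (Module.finrank ℝ E / 2 : ℝ))⁻¹ : ℝ) : ℂ) *
      Complex.exp (-(1 / 2) * ‖x‖ ^ 2 + Complex.I * ⟪t, x⟫) := by
    intro x
    rw [ENNReal.toReal_ofReal (gaussianDensity_pos x).le, gaussianDensity, Complex.exp_add,
      real_inner_comm x t, Complex.real_smul]
    push_cast
    ring_nf
  simp_rw [h2]
  rw [integral_const_mul, h]
  have h3 : (((2 * Real.pi) ^ (Module.finrank ℝ E / 2 : ℝ) : ℝ) : ℂ) =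
      (Real.pi / (1 / 2) : ℂ) ^ (Module.finrank ℝ E / 2 : ℂ) := by
    rw [Complex.ofReal_cpow (by positivity)]
    push_cast
    ring_nf
  rw [Complex.ofReal_inv, h3, ← mul_assoc, inv_mul_cancel₀, one_mul]
  · rw [Complex.I_sq]
    ring_nf
  · rw [← h3]
    norm_cast
    positivity

lemma integral_stdGaussian (f : E → ℝ) :
    ∫ x, f x ∂(stdGaussian E) = ∫ x, gaussianDensity E x * f x := by
  rw [stdGaussian_eq_withDensity, integral_withDensity_eq_integral_toReal_smul
    (by exact (continuous_gaussianDensity.measurable).ennreal_ofReal) (by simp)]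
  simp [(gaussianDensity_pos _).le]

lemma integrable_stdGaussian_iff (f : E → ℝ) :
    Integrable f (stdGaussian E) ↔ Integrable fun x => gaussianDensity E x * f x := by
  rw [stdGaussian_eq_withDensity, integrable_withDensity_iff_integrable_smul'
    (by exact (continuous_gaussianDensity.measurable).ennreal_ofReal) (by simp)]
  simp [(gaussianDensity_pos _).le]

lemma lintegral_stdGaussian (f : E → ℝ≥0∞) (hf : Measurable f) :
    ∫⁻ x, f x ∂(stdGaussian E) = ∫⁻ x, ENNReal.ofReal (gaussianDensity E x) * f x := by
  rw [stdGaussian_eq_withDensity, lintegral_withDensity_eq_lintegral_mul _ _ hf]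
  · rfl
  · exact (continuous_gaussianDensity.measurable).ennreal_ofReal

lemma stdGaussian_absolutelyContinuous : stdGaussian E ≪ volume := by
  rw [stdGaussian_eq_withDensity]
  exact withDensity_absolutelyContinuous _ _

lemma integrable_norm_stdGaussian : Integrable (fun x : E => ‖x‖) (stdGaussian E) :=
  (IsGaussian.integrable_id (μ := stdGaussian E)).norm

/-- The product of two standard Gaussian measures is invariant under plane rotations followed by
a reflection. -/
lemma measurePreserving_reflect {a b : ℝ} (h : a ^ 2 + b ^ 2 = 1) :
    MeasurePreserving (fun p : E × E => (a • p.1 + b • p.2, b • p.1 - a • p.2))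
      ((stdGaussian E).prod (stdGaussian E)) ((stdGaussian E).prod (stdGaussian E)) := by
  obtain ⟨θ, ha, hb⟩ : ∃ θ : ℝ, a = Real.cos θ ∧ b = Real.sin θ := by
    refine ⟨Complex.arg ⟨a, b⟩, ?_, ?_⟩
    · have h1 : ‖(⟨a, b⟩ : ℂ)‖ = 1 := by
        rw [Complex.norm_eq_sqrt_sq_add_sq]; simp [h]
      rw [Complex.cos_arg (by intro h0; rw [h0] at h1; simp at h1), h1]; simp
    · have h1 : ‖(⟨a, b⟩ : ℂ)‖ = 1 := by
        rw [Complex.norm_eq_sqrt_sq_add_sq]; simp [h]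
      rw [Complex.sin_arg, h1]; simp
  have h1 : MeasurePreserving (ContinuousLinearMap.rotation (E := E) θ)
      ((stdGaussian E).prod (stdGaussian E)) ((stdGaussian E).prod (stdGaussian E)) :=
    ⟨(ContinuousLinearMap.rotation (E := E) θ).continuous.measurable,
      IsGaussian.map_rotation_eq_self_of_forall_strongDual_eq_zero
        (fun L => integral_strongDual_stdGaussian L) θ⟩
  have h2 : MeasurePreserving (fun x : E => -x) (stdGaussian E) (stdGaussian E) :=
    ⟨measurable_neg, stdGaussian_map (LinearIsometryEquiv.neg ℝ)⟩
  have h3 := ((MeasurePreserving.id (stdGaussian E)).prod h2).comp h1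
  convert! h3 using 1
  ext p
  · simp [ContinuousLinearMap.rotation_apply, ha, hb]
  · simp [ContinuousLinearMap.rotation_apply, ha, hb]
    abel

/-- Gaussian integration by parts. -/
lemma integral_mul_inner_stdGaussian {H : E → ℝ} (hH : ContDiff ℝ 1 H) {C : ℝ}
    (hb : ∀ x, |H x| ≤ C) (hb' : ∀ x, ‖fderiv ℝ H x‖ ≤ C) (a : E) :
    ∫ x, H x * ⟪a, x⟫ ∂(stdGaussian E) = ∫ x, fderiv ℝ H x a ∂(stdGaussian E) := by
  -- The density has gradient `-x` times itself, so integration by parts against Lebesgue measure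
  -- trades the factor `⟪a, x⟫` for the derivative along `a`.
  have hg : ∀ x : E, HasFDerivAt (gaussianDensity E)
      (gaussianDensity E x • -(innerSL ℝ x)) x := by
    intro x
    have h1 : HasFDerivAt (fun x : E => ‖x‖ ^ 2) (2 • (innerSL ℝ x)) x :=
      (hasStrictFDerivAt_norm_sq x).hasFDerivAt
    have h2 := ((h1.const_mul (-1 / 2 : ℝ)).exp).const_mul
      ((2 * Real.pi) ^ (Module.finrank ℝ E / 2 : ℝ))⁻¹
    have h3 : (fun x : E => ((2 * Real.pi) ^ (Module.finrank ℝ E / 2 : ℝ))⁻¹ *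
        Real.exp (-1 / 2 * ‖x‖ ^ 2)) = gaussianDensity E := by
      ext x; unfold gaussianDensity; ring_nf
    rw [h3] at h2
    convert! h2 using 1
    ext v
    simp [gaussianDensity]
    ring_nf
  have hcont' : Continuous fun x => fderiv ℝ H x a :=
    (hH.continuous_fderiv (by simp)).clm_apply continuous_const
  have hI1 : Integrable (fun x => H x * ⟪a, x⟫) (stdGaussian E) := by
    refine Integrable.mono' (integrable_norm_stdGaussian.const_mul (C * ‖a‖))
      (hH.continuous.mul (by fun_prop)).aestronglyMeasurable
      (Filter.Eventually.of_forall fun x => ?_)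
    rw [norm_mul, Real.norm_eq_abs, mul_assoc]
    exact mul_le_mul (hb x) (norm_inner_le_norm a x) (norm_nonneg _)
      ((abs_nonneg _).trans (hb x))
  have hI2 : Integrable (fun x => fderiv ℝ H x a) (stdGaussian E) := by
    refine Integrable.mono' (integrable_const (C * ‖a‖)) hcont'.aestronglyMeasurable
      (Filter.Eventually.of_forall fun x => ?_)
    exact ((fderiv ℝ H x).le_opNorm a).trans (by gcongr; exact hb' x)
  have hI3 : Integrable H (stdGaussian E) := by
    refine Integrable.mono' (integrable_const C) hH.continuous.aestronglyMeasurable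
      (Filter.Eventually.of_forall fun x => hb x)
  rw [integrable_stdGaussian_iff] at hI1 hI2 hI3
  rw [integral_stdGaussian, integral_stdGaussian]
  have hfd : ∀ x, fderiv ℝ (gaussianDensity E) x a = -(gaussianDensity E x * ⟪a, x⟫) := by
    intro x
    rw [(hg x).fderiv]
    simp [real_inner_comm]
  have key := integral_mul_fderiv_eq_neg_fderiv_mul_of_integrable (μ := (volume : Measure E))
    (f := H) (g := gaussianDensity E) (v := a)
    (hI2.congr (Filter.Eventually.of_forall fun x => by ring))
    (hI1.neg.congr (Filter.Eventually.of_forall fun x => by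
      simp only [Pi.neg_apply, hfd]; ring))
    (hI3.congr (Filter.Eventually.of_forall fun x => by ring))
    (fun x _ => hH.differentiable (by simp) x) (fun x _ => (hg x).differentiableAt)
  simp_rw [hfd] at key
  calc ∫ x, gaussianDensity E x * (H x * ⟪a, x⟫)
      = -∫ x, H x * -(gaussianDensity E x * ⟪a, x⟫) := by
        rw [← integral_neg]; congr 1; ext x; ring
    _ = ∫ x, fderiv ℝ H x a * gaussianDensity E x := by rw [key, neg_neg]
    _ = _ := by congr 1; ext x; ring

end Gaussian

/-! ### The Gaussian covariance representation. -/

section Covariance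

variable {E : Type*} [NormedAddCommGroup E] [InnerProductSpace ℝ E] [FiniteDimensional ℝ E]

lemma inner_gradient_eq_fderiv (F : E → ℝ) (x v : E) : ⟪gradient F x, v⟫ = fderiv ℝ F x v := by
  simp [gradient]

lemma norm_gradient_eq (F : E → ℝ) (x : E) : ‖gradient F x‖ = ‖fderiv ℝ F x‖ := by
  simp [gradient]

lemma continuous_gradient {F : E → ℝ} (hF : ContDiff ℝ 1 F) : Continuous (gradient F) :=
  (InnerProductSpace.toDual ℝ E).symm.continuous.comp (hF.continuous_fderiv (by simp))

variable [MeasurableSpace E] [BorelSpace E]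

lemma integral_comp_reflect {a b : ℝ} (h : a ^ 2 + b ^ 2 = 1) {k : E × E → ℝ} (hk : Continuous k) :
    ∫ p, k (a • p.1 + b • p.2, b • p.1 - a • p.2) ∂((stdGaussian E).prod (stdGaussian E)) =
      ∫ p, k p ∂((stdGaussian E).prod (stdGaussian E)) := by
  have hR := measurePreserving_reflect (E := E) h
  conv_rhs => rw [← hR.map_eq]
  rw [integral_map hR.measurable.aemeasurable hk.aestronglyMeasurable]

/-- The map `(u, v) ↦ (a u + b v, b u - a v)` is a measure-preserving involution. It turns the
direction of differentiation into a Gaussian vector independent of the argument of `∇G`. Integration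
by parts in that vector then produces the factor `b`, and the involution is undone. -/
lemma integral_mul_fderiv_rotate {F G : E → ℝ} (hF : ContDiff ℝ 1 F) (hG : ContDiff ℝ 1 G)
    {C : ℝ} (hFb : ∀ x, |F x| ≤ C) (hFb' : ∀ x, ‖gradient F x‖ ≤ C)
    (hGb' : ∀ x, ‖gradient G x‖ ≤ C) {a b : ℝ} (h : a ^ 2 + b ^ 2 = 1) :
    ∫ p : E × E, F p.1 * fderiv ℝ G (a • p.1 + b • p.2) (b • p.1 - a • p.2)
        ∂((stdGaussian E).prod (stdGaussian E)) =
      b * ∫ p : E × E, ⟪gradient F p.1, gradient G (a • p.1 + b • p.2)⟫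
        ∂((stdGaussian E).prod (stdGaussian E)) := by
  have hcF := continuous_gradient hF
  have hcG := continuous_gradient hG
  have hcF0 := hF.continuous
  have hinv : ∀ p : E × E, a • (a • p.1 + b • p.2) + b • (b • p.1 - a • p.2) = p.1 := by
    intro p
    have : a • (a • p.1 + b • p.2) + b • (b • p.1 - a • p.2) = (a ^ 2 + b ^ 2) • p.1 := by module
    rw [this, h, one_smul]
  have h1 := integral_comp_reflect h
    (k := fun q : E × E => F (a • q.1 + b • q.2) * ⟪gradient G q.1, q.2⟫) (by fun_prop)
  have h2 := integral_comp_reflect h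
    (k := fun q : E × E => ⟪gradient F (a • q.1 + b • q.2), gradient G q.1⟫) (by fun_prop)
  simp only [hinv] at h1 h2
  simp_rw [← inner_gradient_eq_fderiv]
  rw [h1, h2]
  have hC : 0 ≤ C := (norm_nonneg _).trans (hFb' 0)
  have hI1 : Integrable (fun q : E × E => F (a • q.1 + b • q.2) * ⟪gradient G q.1, q.2⟫)
      ((stdGaussian E).prod (stdGaussian E)) := by
    refine Integrable.mono' ((integrable_norm_stdGaussian (E := E)).comp_snd (stdGaussian E)
      |>.const_mul (C * C))
      (Continuous.aestronglyMeasurable (by fun_prop)) (Filter.Eventually.of_forall fun q => ?_)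
    rw [norm_mul, Real.norm_eq_abs, mul_assoc]
    refine mul_le_mul (hFb _) ((norm_inner_le_norm _ _).trans ?_) (norm_nonneg _) hC
    gcongr
    exact hGb' _
  have hI2 : Integrable (fun q : E × E => ⟪gradient F (a • q.1 + b • q.2), gradient G q.1⟫)
      ((stdGaussian E).prod (stdGaussian E)) := by
    refine Integrable.mono' (integrable_const (C * C))
      (Continuous.aestronglyMeasurable (by fun_prop)) (Filter.Eventually.of_forall fun q => ?_)
    exact (norm_inner_le_norm _ _).trans
      (mul_le_mul (hFb' _) (hGb' _) (norm_nonneg _) hC)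
  rw [integral_prod _ hI1, integral_prod _ hI2, ← integral_const_mul]
  congr 1
  ext u
  have hd : ∀ v, HasFDerivAt (fun v => F (a • u + b • v)) (b • fderiv ℝ F (a • u + b • v)) v := by
    intro v
    have h3 : HasFDerivAt (fun v : E => a • u + b • v) (b • ContinuousLinearMap.id ℝ E) v :=
      ((hasFDerivAt_id v).const_smul b).const_add _
    convert! ((hF.differentiable (by simp) (a • u + b • v)).hasFDerivAt).comp v h3 using 1
    ext w
    simp
  have h4 : ContDiff ℝ 1 (fun v => F (a • u + b • v)) :=
    hF.comp (contDiff_const.add (contDiff_const.smul contDiff_id))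
  have h5 := integral_mul_inner_stdGaussian h4 (C := max C (|b| * C))
    (fun v => (hFb _).trans (le_max_left _ _))
    (fun v => by
      rw [(hd v).fderiv, norm_smul, ← norm_gradient_eq, Real.norm_eq_abs]
      exact le_max_of_le_right (by gcongr; exact hFb' _)) (gradient G u)
  rw [h5, ← integral_const_mul]
  congr 1
  ext v
  rw [(hd v).fderiv, inner_gradient_eq_fderiv]
  simp

/-- The Gaussian covariance representation, for functions which are bounded with bounded
gradient. -/
theorem gaussian_covariance {F G : E → ℝ} (hF : ContDiff ℝ 1 F) (hG : ContDiff ℝ 1 G)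
    {C : ℝ} (hFb : ∀ x, |F x| ≤ C) (hGb : ∀ x, |G x| ≤ C) (hFb' : ∀ x, ‖gradient F x‖ ≤ C)
    (hGb' : ∀ x, ‖gradient G x‖ ≤ C) :
    ∫ x, F x * G x ∂(stdGaussian E) - (∫ x, F x ∂(stdGaussian E)) * ∫ x, G x ∂(stdGaussian E) =
      ∫ t in (0 : ℝ)..1, ∫ p : E × E, ⟪gradient F p.1, gradient G (t • p.1 + √(1 - t ^ 2) • p.2)⟫
        ∂((stdGaussian E).prod (stdGaussian E)) := by
  have hcF := continuous_gradient hF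
  have hcG := continuous_gradient hG
  have hcF0 := hF.continuous
  have hcG0 := hG.continuous
  have hC : 0 ≤ C := (norm_nonneg _).trans (hFb' 0)
  set J : ℝ → ℝ := fun t =>
    ∫ p : E × E, ⟪gradient F p.1, gradient G (t • p.1 + √(1 - t ^ 2) • p.2)⟫
        ∂((stdGaussian E).prod (stdGaussian E)) with hJ
  have hJc : Continuous J := by
    refine continuous_of_dominated (bound := fun _ => C * C)
      (fun t => Continuous.aestronglyMeasurable (by fun_prop))
      (fun t => Filter.Eventually.of_forall fun p => ?_) (integrable_const _)
      (Filter.Eventually.of_forall fun p => by fun_prop)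
    exact (norm_inner_le_norm _ _).trans (mul_le_mul (hFb' _) (hGb' _) (norm_nonneg _) hC)
  -- `K` passes from the independent pair at `θ = 0` to the equal pair at `θ = π/2`. The angle `t =
  -- sin θ` avoids differentiating `√(1 - t²)` at `t = 1`; the factor `cos θ` in `K'` is the
  -- Jacobian back to `t`.
  set K : ℝ → ℝ := fun θ => ∫ p : E × E, F p.1 * G (Real.sin θ • p.1 + Real.cos θ • p.2)
        ∂((stdGaussian E).prod (stdGaussian E)) with hK
  have hKd : ∀ θ, HasDerivAt K (Real.cos θ * ∫ p : E × E,
      ⟪gradient F p.1, gradient G (Real.sin θ • p.1 + Real.cos θ • p.2)⟫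
        ∂((stdGaussian E).prod (stdGaussian E))) θ := by
    intro θ
    rw [← integral_mul_fderiv_rotate hF hG hFb hFb' hGb' (Real.sin_sq_add_cos_sq θ)]
    have hcG' := hG.continuous_fderiv (by simp)
    refine (hasDerivAt_integral_of_dominated_loc_of_deriv_le (s := Set.univ)
      (F := fun θ (p : E × E) => F p.1 * G (Real.sin θ • p.1 + Real.cos θ • p.2))
      (F' := fun θ (p : E × E) => F p.1 *
        fderiv ℝ G (Real.sin θ • p.1 + Real.cos θ • p.2) (Real.cos θ • p.1 - Real.sin θ • p.2))
      (bound := fun p : E × E => C * (C * (‖p.1‖ + ‖p.2‖))) Filter.univ_mem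
      (Filter.Eventually.of_forall fun t => Continuous.aestronglyMeasurable (by fun_prop))
      ?_ (Continuous.aestronglyMeasurable ?_)
      (Filter.Eventually.of_forall fun p t _ => ?_) ?_
      (Filter.Eventually.of_forall fun p t _ => ?_)).2
    · refine Integrable.mono' (integrable_const (C * C))
        (Continuous.aestronglyMeasurable (by fun_prop)) (Filter.Eventually.of_forall fun p => ?_)
      rw [norm_mul]
      exact mul_le_mul (hFb _) (hGb _) (norm_nonneg _) hC
    · fun_prop
    · rw [norm_mul]
      refine mul_le_mul (hFb _) ((ContinuousLinearMap.le_opNorm _ _).trans ?_) (norm_nonneg _) hC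
      rw [← norm_gradient_eq]
      refine mul_le_mul (hGb' _) ((norm_sub_le _ _).trans ?_) (norm_nonneg _) hC
      rw [norm_smul, norm_smul]
      exact add_le_add (mul_le_of_le_one_left (norm_nonneg _) (Real.abs_cos_le_one t))
        (mul_le_of_le_one_left (norm_nonneg _) (Real.abs_sin_le_one t))
    · exact (((integrable_norm_stdGaussian (E := E)).comp_fst (stdGaussian E)).add
        ((integrable_norm_stdGaussian (E := E)).comp_snd (stdGaussian E))).const_mul C
        |>.const_mul C
    · have h1 : HasDerivAt (fun t => Real.sin t • p.1 + Real.cos t • p.2)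
          (Real.cos t • p.1 - Real.sin t • p.2) t := by
        have := ((Real.hasDerivAt_sin t).smul_const p.1).add
          ((Real.hasDerivAt_cos t).smul_const p.2)
        rwa [neg_smul, ← sub_eq_add_neg] at this
      exact (((hG.differentiable (by simp) _).hasFDerivAt).comp_hasDerivAt t h1).const_mul _
  have hK0 : K 0 = (∫ x, F x ∂(stdGaussian E)) * ∫ x, G x ∂(stdGaussian E) := by
    simp only [hK, Real.sin_zero, Real.cos_zero, zero_smul, one_smul, zero_add]
    exact integral_prod_mul F G
  have hK1 : K (Real.pi / 2) = ∫ x, F x * G x ∂(stdGaussian E) := by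
    simp only [hK, Real.sin_pi_div_two, Real.cos_pi_div_two, zero_smul, one_smul, add_zero]
    have := integral_prod_mul (μ := stdGaussian E) (ν := stdGaussian E)
      (fun x => F x * G x) (fun _ => (1 : ℝ))
    simpa using this
  have hcosJ : ∀ θ ∈ Set.uIcc 0 (Real.pi / 2), HasDerivAt K (J (Real.sin θ) * Real.cos θ) θ := by
    intro θ hθ
    rw [Set.uIcc_of_le (by positivity)] at hθ
    have h1 : √(1 - Real.sin θ ^ 2) = Real.cos θ := by
      rw [← Real.cos_sq', Real.sqrt_sq
        (Real.cos_nonneg_of_mem_Icc ⟨by linarith [hθ.1, Real.pi_pos], hθ.2⟩)]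
    have := hKd θ
    rw [mul_comm] at this
    simpa only [hJ, h1] using this
  have hFTC := intervalIntegral.integral_eq_sub_of_hasDerivAt hcosJ
    (Continuous.intervalIntegrable (by fun_prop) _ _)
  have hsub := intervalIntegral.integral_comp_mul_deriv (a := 0) (b := Real.pi / 2)
    (f := Real.sin) (f' := Real.cos) (g := J) (fun x _ => Real.hasDerivAt_sin x)
    Real.continuous_cos.continuousOn hJc
  rw [← hK1, ← hK0, ← hFTC]
  simpa using hsub

end Covariance

/-! ### Polar coordinates and the uniform distribution on the sphere. -/

section Polar

variable {n : ℕ}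

lemma nonempty_sph (hn : 1 ≤ n) : Nonempty (Sph n) := by
  have : Nonempty (Fin n) := ⟨⟨0, hn⟩⟩
  exact (NormedSpace.sphere_nonempty.2 zero_le_one).to_subtype

/-- The radial projection onto the sphere, sending the origin to `e`. -/
def radial (e : Sph n) (y : Space n) : Sph n :=
  if h : y = 0 then e else ⟨‖y‖⁻¹ • y, by simp [norm_smul, h]⟩

lemma coe_radial (e : Sph n) {y : Space n} (hy : y ≠ 0) :
    (radial e y : Space n) = ‖y‖⁻¹ • y := by
  simp [radial, hy]

lemma radial_smul (e : Sph n) {r : ℝ} (hr : 0 < r) (u : Sph n) :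
    radial e (r • (u : Space n)) = u := by
  have hu : (u : Space n) ≠ 0 := ne_zero_of_mem_unit_sphere u
  ext1
  rw [coe_radial _ (smul_ne_zero hr.ne' hu)]
  simp [norm_smul, abs_of_pos hr, smul_smul, hr.ne']

lemma radial_smul' (e : Sph n) {r : ℝ} (hr : 0 < r) (x : Space n) :
    radial e (r • x) = radial e x := by
  by_cases hx : x = 0
  · simp [hx]
  ext1
  rw [coe_radial _ (smul_ne_zero hr.ne' hx), coe_radial _ hx]
  simp [norm_smul, abs_of_pos hr, smul_smul]
  field_simp

lemma measurable_radial (e : Sph n) : Measurable (radial e) := by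
  have h : (fun y => (radial e y : Space n)) =
      fun y => if y = 0 then (e : Space n) else ‖y‖⁻¹ • y := by
    ext1 y
    by_cases hy : y = 0 <;> simp [radial, hy]
  refine (MeasurableEmbedding.subtype_coe
    (Metric.isClosed_sphere.measurableSet)).measurable_comp_iff.1 ?_
  change Measurable fun y => (radial e y : Space n)
  rw [h]
  exact Measurable.ite (measurableSet_singleton 0) measurable_const (by fun_prop)

/-- Integration in polar coordinates. -/
lemma lintegral_polar (hn : 1 ≤ n) {f : Space n → ℝ≥0∞} (hf : Measurable f) :
    ∫⁻ x, f x = ∫⁻ u : Sph n, (∫⁻ r in Set.Ioi (0 : ℝ),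
      ENNReal.ofReal (r ^ (n - 1)) * f (r • (u : Space n)))
        ∂((volume : Measure (Space n)).toSphere) := by
  have : Nonempty (Fin n) := ⟨⟨0, hn⟩⟩
  have hmp := (volume : Measure (Space n)).measurePreserving_homeomorphUnitSphereProd
  have h1 : ∫⁻ x, f x = ∫⁻ x : ({0}ᶜ : Set (Space n)), f x
      ∂(Measure.comap (↑) (volume : Measure (Space n))) := by
    rw [lintegral_subtype_comap (measurableSet_singleton (0 : Space n)).compl,
      restrict_compl_singleton]
  have h2 : ∀ x : ({0}ᶜ : Set (Space n)), f x =
      (fun p : Sph n × Set.Ioi (0 : ℝ) => f ((p.2 : ℝ) • (p.1 : Space n)))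
        (homeomorphUnitSphereProd (Space n) x) := by
    intro x
    have hx : (x : Space n) ≠ 0 := x.2
    simp [smul_smul, hx]
  have hm : Measurable
      (fun p : Sph n × Set.Ioi (0 : ℝ) => f ((p.2 : ℝ) • (p.1 : Space n))) :=
    hf.comp (by fun_prop)
  rw [h1]
  simp_rw [h2]
  rw [hmp.lintegral_comp hm, lintegral_prod _ hm.aemeasurable]
  refine lintegral_congr fun u => ?_
  rw [Measure.volumeIoiPow, lintegral_withDensity_eq_lintegral_mul]
  · rw [← lintegral_subtype_comap measurableSet_Ioi]
    simp
  · fun_prop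
  · exact hf.comp (by fun_prop)

lemma toSphere_univ_ne_zero (hn : 1 ≤ n) :
    (volume : Measure (Space n)).toSphere Set.univ ≠ 0 := by
  have : Nonempty (Fin n) := ⟨⟨0, hn⟩⟩
  rw [Ne, Measure.measure_univ_eq_zero]
  exact Measure.toSphere_ne_zero _

lemma toSphere_eq_smul_sigma (hn : 1 ≤ n) : (volume : Measure (Space n)).toSphere =
    (volume : Measure (Space n)).toSphere Set.univ • sigma n := by
  rw [sigma, smul_smul, ENNReal.mul_inv_cancel (toSphere_univ_ne_zero hn) (measure_ne_top _ _),
    one_smul]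

lemma toSphere_univ (hn : 1 ≤ n) : (volume : Measure (Space n)).toSphere Set.univ =
    ENNReal.ofReal (2 * √Real.pi ^ n / Real.Gamma (n / 2)) := by
  have : Nonempty (Fin n) := ⟨⟨0, hn⟩⟩
  have hn' : (0 : ℝ) < n := by exact_mod_cast hn
  have hG := Real.Gamma_pos_of_pos (half_pos hn')
  rw [Measure.toSphere_apply_univ, EuclideanSpace.volume_ball, finrank_euclideanSpace,
    Fintype.card_fin, Real.Gamma_add_one (by positivity), ENNReal.ofReal_one, one_pow, one_mul,
    ← ENNReal.ofReal_natCast n, ← ENNReal.ofReal_mul (by positivity)]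
  congr 1
  field_simp

lemma isProbabilityMeasure_sigma (hn : 1 ≤ n) : IsProbabilityMeasure (sigma n) := by
  constructor
  rw [sigma, Measure.smul_apply, smul_eq_mul, ENNReal.inv_mul_cancel (toSphere_univ_ne_zero hn)
    (measure_ne_top _ _)]

instance : SFinite (sigma n) := by unfold sigma; infer_instance

lemma isOpenPosMeasure_sigma : (sigma n).IsOpenPosMeasure := by
  refine Measure.IsOpenPosMeasure.mk fun U hU hne => ?_
  rw [sigma, Measure.smul_apply, smul_eq_mul]
  exact mul_ne_zero (ENNReal.inv_ne_zero.2 (measure_ne_top _ _)) (hU.measure_ne_zero _ hne)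

/-- The radial projection of the standard Gaussian measure is the uniform distribution. -/
lemma map_radial_stdGaussian (hn : 1 ≤ n) (e : Sph n) :
    (stdGaussian (Space n)).map (radial e) = sigma n := by
  set q : ℝ≥0∞ := ∫⁻ r in Set.Ioi (0 : ℝ), ENNReal.ofReal (r ^ (n - 1)) *
    ENNReal.ofReal (((2 * Real.pi) ^ (Module.finrank ℝ (Space n) / 2 : ℝ))⁻¹ *
      Real.exp (-r ^ 2 / 2)) with hq
  have key : ∀ k : Sph n → ℝ≥0∞, Measurable k → ∫⁻ x, k (radial e x) ∂(stdGaussian (Space n)) =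
      q * (volume : Measure (Space n)).toSphere Set.univ * ∫⁻ u, k u ∂(sigma n) := by
    intro k hk
    have hkr : Measurable fun x => k (radial e x) := hk.comp (measurable_radial e)
    have hg : Measurable fun x => ENNReal.ofReal (gaussianDensity (Space n) x) :=
      continuous_gaussianDensity.measurable.ennreal_ofReal
    rw [lintegral_stdGaussian _ hkr, lintegral_polar hn
      (f := fun x => ENNReal.ofReal (gaussianDensity (Space n) x) * k (radial e x)) (hg.mul hkr)]
    conv_lhs => rw [toSphere_eq_smul_sigma hn]
    rw [lintegral_smul_measure, smul_eq_mul, mul_comm q, mul_assoc, ← lintegral_const_mul _ hk]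
    congr 1
    refine lintegral_congr fun u => ?_
    rw [hq, ← lintegral_mul_const _ (by fun_prop)]
    refine setLIntegral_congr_fun measurableSet_Ioi fun r hr => ?_
    have hr : 0 < r := hr
    simp only [radial_smul e hr u, gaussianDensity, norm_smul,
      norm_eq_of_mem_sphere, mul_one, Real.norm_eq_abs, sq_abs, mul_assoc]
  -- The constant function `1` evaluates the common factor in `key`, so the radial integral `q` need
  -- not be computed.
  have h1 := key (fun _ => 1) measurable_const
  have := isProbabilityMeasure_sigma hn
  simp only [lintegral_one, measure_univ, mul_one] at h1
  refine Measure.ext_of_lintegral _ fun k hk => ?_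
  rw [lintegral_map hk (measurable_radial e), key k hk, ← h1, one_mul]

end Polar

/-! ### The kernel `ψ_n` from correlated Gaussian vectors. -/

section Kernel

lemma lintegral_comp_pos_smul {E : Type*} [NormedAddCommGroup E] [NormedSpace ℝ E]
    [FiniteDimensional ℝ E] [MeasurableSpace E] [BorelSpace E] (μ : Measure E) [μ.IsAddHaarMeasure]
    (g : E → ℝ≥0∞) {s : ℝ} (hs : 0 < s) :
    ∫⁻ x, g x ∂μ = ENNReal.ofReal (s ^ Module.finrank ℝ E) * ∫⁻ x, g (s • x) ∂μ := by
  have h1 := (Homeomorph.smulOfNeZero s hs.ne' (α := E)).measurableEmbedding.lintegral_map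
    (μ := μ) g
  simp only [Homeomorph.smulOfNeZero_apply] at h1
  have h2 := Measure.map_addHaar_smul μ hs.ne'
  rw [← h1, h2, lintegral_smul_measure, smul_eq_mul, ← mul_assoc,
    ← ENNReal.ofReal_mul (by positivity), abs_of_pos (by positivity),
    mul_inv_cancel₀ (by positivity), ENNReal.ofReal_one, one_mul]

variable {n : ℕ}

/-- The law of a pair of correlated Gaussian vectors. -/
lemma lintegral_correlated {s t : ℝ} (hs : 0 < s) (hst : t ^ 2 + s ^ 2 = 1)
    {h : Space n × Space n → ℝ≥0∞} (hh : Measurable h) :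
    ∫⁻ p : Space n × Space n, h (p.1, t • p.1 + s • p.2)
        ∂((stdGaussian (Space n)).prod (stdGaussian (Space n))) =
      ENNReal.ofReal (((2 * Real.pi) ^ n)⁻¹ * s ^ n) * ∫⁻ x : Space n, ∫⁻ y : Space n,
        h (s • x, s • y) *
          ENNReal.ofReal (Real.exp (-(‖x‖ ^ 2 + ‖y‖ ^ 2 - 2 * t * ⟪x, y⟫) / 2)) := by
  have hm : Measurable fun p : Space n × Space n => h (p.1, t • p.1 + s • p.2) :=
    hh.comp (by fun_prop)
  have hD : Measurable fun x => ENNReal.ofReal (gaussianDensity (Space n) x) :=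
    continuous_gaussianDensity.measurable.ennreal_ofReal
  have hm2 : Measurable fun p : Space n × Space n =>
      ENNReal.ofReal (gaussianDensity (Space n) p.2) * h (p.1, t • p.1 + s • p.2) :=
    (hD.comp measurable_snd).mul hm
  rw [lintegral_prod _ hm.aemeasurable]
  have h1 : ∀ x : Space n, ∫⁻ z, h (x, t • x + s • z) ∂(stdGaussian (Space n)) =
      ∫⁻ z, ENNReal.ofReal (gaussianDensity (Space n) z) * h (x, t • x + s • z) := fun x =>
    lintegral_stdGaussian _ (hm.comp measurable_prodMk_left)
  simp_rw [h1]
  -- Substitute `x → s x`, then `z = y - t x`. Since `t² + s² = 1`, the exponent `s²|x|² + |y - t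
  -- x|²` becomes `|x|² + |y|² - 2t⟨x, y⟩`, free of `s`.
  rw [lintegral_stdGaussian _ hm2.lintegral_prod_right', lintegral_comp_pos_smul volume _ hs,
    mul_comm (((2 * Real.pi) ^ n)⁻¹), ENNReal.ofReal_mul (by positivity), mul_assoc,
    finrank_euclideanSpace, Fintype.card_fin]
  congr 1
  rw [← lintegral_const_mul']
  swap
  · exact ENNReal.ofReal_ne_top
  refine lintegral_congr fun x => ?_
  rw [← lintegral_const_mul' _ _ ENNReal.ofReal_ne_top,
    ← lintegral_const_mul' _ _ ENNReal.ofReal_ne_top, ← lintegral_sub_right_eq_self _ (t • x)]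
  refine lintegral_congr fun y => ?_
  have h2 : t • s • x + s • (y - t • x) = s • y := by module
  rw [h2, ← mul_assoc, ← ENNReal.ofReal_mul (gaussianDensity_pos _).le, mul_comm (h _), ← mul_assoc,
    ← ENNReal.ofReal_mul (by positivity)]
  congr 2
  unfold gaussianDensity
  have h3 : ((2 * Real.pi) ^ n : ℝ) = (2 * Real.pi) ^ (Module.finrank ℝ (Space n) / 2 : ℝ) *
      (2 * Real.pi) ^ (Module.finrank ℝ (Space n) / 2 : ℝ) := by
    rw [← Real.rpow_add (by positivity), add_halves, finrank_euclideanSpace, Fintype.card_fin,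
      Real.rpow_natCast]
  rw [h3, mul_inv, mul_mul_mul_comm, ← Real.exp_add]
  congr 2
  rw [norm_sub_sq_real, norm_smul, norm_smul, mul_pow, mul_pow, Real.norm_eq_abs, Real.norm_eq_abs,
    sq_abs, sq_abs, real_inner_smul_right, real_inner_comm x y]
  linear_combination (-‖x‖ ^ 2 / 2) * hst

/-- The inner double integral in the definition of `psi`. -/
def innerPsi (n : ℕ) (β : ℝ) : ℝ≥0∞ :=
  ∫⁻ r in Set.Ioi (0 : ℝ), ∫⁻ r' in Set.Ioi (0 : ℝ),
    ENNReal.ofReal (Real.exp (-(r ^ 2 + r' ^ 2 - 2 * r * r' * β) / 2) * (r * r') ^ (n - 2))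

lemma measurable_innerPsi : Measurable (innerPsi n) := by
  unfold innerPsi
  have h : Measurable fun q : (ℝ × ℝ) × ℝ => ENNReal.ofReal
      (Real.exp (-(q.1.2 ^ 2 + q.2 ^ 2 - 2 * q.1.2 * q.2 * q.1.1) / 2) * (q.1.2 * q.2) ^ (n - 2)) :=
    (Continuous.measurable (by fun_prop)).ennreal_ofReal
  exact (h.lintegral_prod_right' (ν := volume.restrict (Set.Ioi 0))).lintegral_prod_right'
    (ν := volume.restrict (Set.Ioi 0))

/-- The constant in the definition of `psi`. -/
def psiConst (n : ℕ) : ℝ := 1 / (2 ^ (n - 2) * Real.Gamma ((n : ℝ) / 2) ^ 2)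

lemma psi_eq (n : ℕ) (α : ℝ) : psi n α = ENNReal.ofReal (psiConst n) *
    ∫⁻ t in Set.Ioo (0 : ℝ) 1, ENNReal.ofReal (√(1 - t ^ 2) ^ (n - 2)) * innerPsi n (t * α) := by
  simp only [psi, psiConst, innerPsi, mul_assoc]

lemma measurable_psi : Measurable (psi n) := by
  have h : Measurable fun p : ℝ × ℝ =>
      ENNReal.ofReal (√(1 - p.2 ^ 2) ^ (n - 2)) * innerPsi n (p.2 * p.1) :=
    (Continuous.measurable (by fun_prop)).ennreal_ofReal.mul
      (measurable_innerPsi.comp (by fun_prop))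
  simp_rw [funext (psi_eq n)]
  exact (h.lintegral_prod_right' (ν := volume.restrict (Set.Ioo 0 1))).const_mul _

/-- This is the origin of the constant in `psi`: two changes to polar coordinates give the squared
surface area, and the two Gaussian densities give `(2π)⁻ⁿ`. -/
lemma psiConst_eq (hn : 2 ≤ n) : ENNReal.ofReal (psiConst n) =
    (volume : Measure (Space n)).toSphere Set.univ ^ 2 * ENNReal.ofReal ((2 * Real.pi) ^ n)⁻¹ := by
  have hG : 0 < Real.Gamma (n / 2) := Real.Gamma_pos_of_pos (by positivity)
  rw [toSphere_univ (by omega), ← ENNReal.ofReal_pow (by positivity),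
    ← ENNReal.ofReal_mul (by positivity), psiConst]
  congr 1
  have h1 : (√Real.pi ^ n) ^ 2 = Real.pi ^ n := by
    rw [← pow_mul, mul_comm, pow_mul, Real.sq_sqrt Real.pi_pos.le]
  obtain ⟨m, rfl⟩ : ∃ m, n = m + 2 := ⟨n - 2, by omega⟩
  rw [div_pow, mul_pow, h1, Nat.add_sub_cancel, mul_pow, pow_add]
  have := Real.pi_pos
  field_simp
  ring

/-- Integration in polar coordinates in both variables. -/
lemma lintegral_polar_polar (hn : 1 ≤ n) {f : Space n × Space n → ℝ≥0∞} (hf : Measurable f) :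
    ∫⁻ x, ∫⁻ y, f (x, y) = (volume : Measure (Space n)).toSphere Set.univ ^ 2 *
      ∫⁻ u, ∫⁻ v, (∫⁻ r in Set.Ioi (0 : ℝ), ∫⁻ r' in Set.Ioi (0 : ℝ),
        ENNReal.ofReal (r ^ (n - 1)) * (ENNReal.ofReal (r' ^ (n - 1)) *
          f (r • (u : Space n), r' • (v : Space n)))) ∂(sigma n) ∂(sigma n) := by
  have hS := toSphere_eq_smul_sigma hn
  have hpol : ∀ g : Space n → ℝ≥0∞, Measurable g → ∫⁻ x, g x =
      (volume : Measure (Space n)).toSphere Set.univ * ∫⁻ u : Sph n, (∫⁻ r in Set.Ioi (0 : ℝ),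
      ENNReal.ofReal (r ^ (n - 1)) * g (r • (u : Space n))) ∂(sigma n) := by
    intro g hg
    rw [lintegral_polar hn hg]
    conv_lhs => rw [hS]
    rw [lintegral_smul_measure, smul_eq_mul]
  rw [hpol _ hf.lintegral_prod_right', pow_two, mul_assoc]
  congr 1
  rw [← lintegral_const_mul' _ _ (measure_ne_top _ _)]
  refine lintegral_congr fun u => ?_
  have hq : Measurable fun q : (ℝ × Sph n) × ℝ => ENNReal.ofReal (q.2 ^ (n - 1)) *
      f (q.1.1 • (u : Space n), q.2 • (q.1.2 : Space n)) := by
    refine Measurable.mul (by fun_prop) (hf.comp ?_)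
    fun_prop
  have hq' : Measurable fun q : (ℝ × Sph n) => ∫⁻ r' in Set.Ioi (0 : ℝ),
      ENNReal.ofReal (r' ^ (n - 1)) * f (q.1 • (u : Space n), r' • (q.2 : Space n)) :=
    hq.lintegral_prod_right' (ν := volume.restrict (Set.Ioi 0))
  have hpol' : ∀ x, ∫⁻ y, f (x, y) =
      (volume : Measure (Space n)).toSphere Set.univ * ∫⁻ v : Sph n, (∫⁻ r' in Set.Ioi (0 : ℝ),
      ENNReal.ofReal (r' ^ (n - 1)) * f (x, r' • (v : Space n))) ∂(sigma n) :=
    fun x => hpol _ (hf.comp (measurable_prodMk_left (x := x)))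
  have h1 : ∀ r : ℝ, ENNReal.ofReal (r ^ (n - 1)) *
      ((volume : Measure (Space n)).toSphere Set.univ * ∫⁻ v : Sph n, (∫⁻ r' in Set.Ioi (0 : ℝ),
      ENNReal.ofReal (r' ^ (n - 1)) * f (r • (u : Space n), r' • (v : Space n))) ∂(sigma n)) =
      (volume : Measure (Space n)).toSphere Set.univ * ∫⁻ v : Sph n,
        ENNReal.ofReal (r ^ (n - 1)) * (∫⁻ r' in Set.Ioi (0 : ℝ),
      ENNReal.ofReal (r' ^ (n - 1)) * f (r • (u : Space n), r' • (v : Space n))) ∂(sigma n) := by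
    intro r
    rw [mul_left_comm, lintegral_const_mul' _ _ ENNReal.ofReal_ne_top]
  simp only [hpol', h1]
  rw [lintegral_const_mul' _ _ (measure_ne_top _ _), lintegral_lintegral_swap]
  · congr 1
    refine lintegral_congr fun v => lintegral_congr fun r => ?_
    rw [lintegral_const_mul' _ _ ENNReal.ofReal_ne_top]
  · exact ((Measurable.ennreal_ofReal (by fun_prop)).mul hq').aemeasurable

/-- The weights `1/(s r)` and `1/(s r')` lower the polar Jacobians to `(r r')^(n-2)` and leave
`s⁻²`. With the `sⁿ` of `lintegral_correlated` this makes the `s^(n-2)` of `psi`. -/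
lemma lintegral_radii_correlated (hn : 2 ≤ n) (e : Sph n) {s : ℝ} (hs : 0 < s) (t : ℝ)
    (k : Sph n × Sph n → ℝ≥0∞) (u v : Sph n) :
      ∫⁻ r in Set.Ioi (0 : ℝ), ∫⁻ r' in Set.Ioi (0 : ℝ),
        ENNReal.ofReal (r ^ (n - 1)) * (ENNReal.ofReal (r' ^ (n - 1)) *
          (k (radial e (s • r • (u : Space n)), radial e (s • r' • (v : Space n))) *
            ENNReal.ofReal (‖s • r • (u : Space n)‖⁻¹ * ‖s • r' • (v : Space n)‖⁻¹) *
            ENNReal.ofReal (Real.exp (-(‖r • (u : Space n)‖ ^ 2 + ‖r' • (v : Space n)‖ ^ 2 -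
              2 * t * ⟪r • (u : Space n), r' • (v : Space n)⟫) / 2)))) =
      ENNReal.ofReal ((s ^ 2)⁻¹) * (k (u, v) * innerPsi n (t * ⟪(u : Space n), (v : Space n)⟫)) := by
  rw [innerPsi, ← mul_assoc, ← lintegral_const_mul _ (Measurable.lintegral_prod_right'
    (f := fun q : ℝ × ℝ => ENNReal.ofReal (Real.exp (-(q.1 ^ 2 + q.2 ^ 2 -
      2 * q.1 * q.2 * (t * ⟪(u : Space n), (v : Space n)⟫)) / 2) * (q.1 * q.2) ^ (n - 2)))
    (Continuous.measurable (by fun_prop)).ennreal_ofReal)]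
  refine setLIntegral_congr_fun measurableSet_Ioi fun r hr => ?_
  have hr : 0 < r := hr
  simp only
  rw [← lintegral_const_mul _ (Continuous.measurable (by fun_prop)).ennreal_ofReal]
  refine setLIntegral_congr_fun measurableSet_Ioi fun r' hr' => ?_
  have hr' : 0 < r' := hr'
  simp only [radial_smul' e hs, radial_smul e hr, radial_smul e hr', norm_smul,
    norm_eq_of_mem_sphere, mul_one, Real.norm_eq_abs, abs_of_pos hs, abs_of_pos hr,
    abs_of_pos hr', real_inner_smul_left, real_inner_smul_right]
  rw [mul_comm (ENNReal.ofReal _) (k (u, v)), mul_assoc (k (u, v)), mul_assoc (k (u, v)),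
    mul_left_comm _ (k (u, v)), mul_left_comm _ (k (u, v))]
  congr 1
  rw [← ENNReal.ofReal_mul (by positivity), ← ENNReal.ofReal_mul (by positivity),
    ← ENNReal.ofReal_mul (by positivity), ← ENNReal.ofReal_mul (by positivity)]
  congr 1
  obtain ⟨m, rfl⟩ : ∃ m, n = m + 2 := ⟨n - 2, by omega⟩
  rw [Nat.add_sub_cancel, show m + 2 - 1 = m + 1 by omega, mul_pow, pow_succ, pow_succ,
    show 2 * t * (r' * (r * ⟪(u : Space (m + 2)), (v : Space (m + 2))⟫)) =
      2 * r * r' * (t * ⟪(u : Space (m + 2)), (v : Space (m + 2))⟫) by ring]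
  field_simp

/-- The kernel `innerPsi` describes the directions of a pair of correlated Gaussian vectors,
weighted by the reciprocals of their lengths. -/
lemma lintegral_correlated_radial (hn : 2 ≤ n) (e : Sph n) {s t : ℝ} (hs : 0 < s)
    (hst : t ^ 2 + s ^ 2 = 1) {k : Sph n × Sph n → ℝ≥0∞} (hk : Measurable k) :
    ∫⁻ p : Space n × Space n, k (radial e p.1, radial e (t • p.1 + s • p.2)) *
        ENNReal.ofReal (‖p.1‖⁻¹ * ‖t • p.1 + s • p.2‖⁻¹)
        ∂((stdGaussian (Space n)).prod (stdGaussian (Space n))) =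
      ENNReal.ofReal (psiConst n) * (ENNReal.ofReal (s ^ (n - 2)) *
        ∫⁻ u, ∫⁻ v, k (u, v) * innerPsi n (t * ⟪(u : Space n), (v : Space n)⟫)
          ∂(sigma n) ∂(sigma n)) := by
  have hr := measurable_radial e
  have hm : Measurable fun p : Space n × Space n =>
      k (radial e p.1, radial e p.2) * ENNReal.ofReal (‖p.1‖⁻¹ * ‖p.2‖⁻¹) :=
    (hk.comp ((hr.comp measurable_fst).prodMk (hr.comp measurable_snd))).mul (by fun_prop)
  set f : Space n × Space n → ℝ≥0∞ := fun p =>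
      k (radial e (s • p.1), radial e (s • p.2)) * ENNReal.ofReal (‖s • p.1‖⁻¹ * ‖s • p.2‖⁻¹) *
      ENNReal.ofReal (Real.exp (-(‖p.1‖ ^ 2 + ‖p.2‖ ^ 2 - 2 * t * ⟪p.1, p.2⟫) / 2)) with hf
  have hm2 : Measurable f :=
    (hm.comp (show Measurable fun p : Space n × Space n => (s • p.1, s • p.2) by fun_prop)).mul
      (Continuous.measurable (by fun_prop)).ennreal_ofReal
  refine (lintegral_correlated hs hst hm).trans ?_
  change ENNReal.ofReal (((2 * Real.pi) ^ n)⁻¹ * s ^ n) *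
    ∫⁻ x : Space n, ∫⁻ y : Space n, f (x, y) = _
  rw [lintegral_polar_polar (by omega) hm2]
  simp only [hf, lintegral_radii_correlated hn e hs t k]
  simp_rw [lintegral_const_mul' _ _ ENNReal.ofReal_ne_top]
  rw [psiConst_eq hn, ← mul_assoc, ← mul_assoc, ← mul_assoc]
  congr 1
  rw [mul_comm (_ ^ 2), mul_right_comm, mul_right_comm _ (_ ^ 2),
    ← ENNReal.ofReal_mul (by positivity), ← ENNReal.ofReal_mul (by positivity)]
  congr 2
  obtain ⟨m, rfl⟩ : ∃ m, n = m + 2 := ⟨n - 2, by omega⟩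
  rw [Nat.add_sub_cancel, pow_add s]
  field_simp

end Kernel

/-! ### The measure `ν_n` as a weighted law of directions. -/

section Nu

variable {n : ℕ}

/-- The parameter space of the Gaussian interpolation: a time in `(0, 1)` and two independent
standard Gaussian vectors. -/
def interpMeasure (n : ℕ) : Measure (ℝ × Space n × Space n) :=
  (volume.restrict (Set.Ioo (0 : ℝ) 1)).prod ((stdGaussian (Space n)).prod (stdGaussian (Space n)))

instance : IsProbabilityMeasure (volume.restrict (Set.Ioo (0 : ℝ) 1)) := ⟨by simp⟩

instance : IsProbabilityMeasure (interpMeasure n) := by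
  unfold interpMeasure; infer_instance

/-- The interpolated Gaussian vector, with correlation `t` with the first vector. -/
def interp (q : ℝ × Space n × Space n) : Space n := q.1 • q.2.1 + √(1 - q.1 ^ 2) • q.2.2

lemma continuous_interp : Continuous (interp (n := n)) := by
  unfold interp
  fun_prop

/-- The weight of the pair of directions. -/
def weight (q : ℝ × Space n × Space n) : ℝ := ‖q.2.1‖⁻¹ * ‖interp q‖⁻¹

lemma weight_nonneg (q : ℝ × Space n × Space n) : 0 ≤ weight q := by
  unfold weight
  positivity

lemma measurable_weight : Measurable (weight (n := n)) :=
  (measurable_fst.comp measurable_snd).norm.inv.mul continuous_interp.measurable.norm.inv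

lemma measurable_radial_interp (e : Sph n) :
    Measurable fun q : ℝ × Space n × Space n => (radial e q.2.1, radial e (interp q)) :=
  ((measurable_radial e).comp (measurable_fst.comp measurable_snd)).prodMk
    ((measurable_radial e).comp continuous_interp.measurable)

lemma measurable_psi_inner : Measurable fun p : Sph n × Sph n =>
    psi n ⟪(p.1 : Space n), (p.2 : Space n)⟫ :=
  measurable_psi.comp (Continuous.measurable (by fun_prop))

/-- By Tonelli the integral over `t` in `psi` moves outside, and each fixed `t` is
`lintegral_correlated_radial`. Working in `[0, ∞]` allows finiteness of `ν_n` for `n ≥ 3` to be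
deduced from this identity. -/
lemma lintegral_nu (hn : 2 ≤ n) (e : Sph n) {k : Sph n × Sph n → ℝ≥0∞} (hk : Measurable k) :
    ∫⁻ p, k p ∂(nu n) = ∫⁻ q, k (radial e q.2.1, radial e (interp q)) * ENNReal.ofReal (weight q)
      ∂(interpMeasure n) := by
  have hm : Measurable fun q : ℝ × Space n × Space n =>
      k (radial e q.2.1, radial e (interp q)) * ENNReal.ofReal (weight q) :=
    (hk.comp (measurable_radial_interp e)).mul measurable_weight.ennreal_ofReal
  have hk2 : Measurable fun q : (Sph n × Sph n) × ℝ =>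
      k q.1 * innerPsi n (q.2 * ⟪(q.1.1 : Space n), (q.1.2 : Space n)⟫) :=
    (hk.comp measurable_fst).mul (measurable_innerPsi.comp (Continuous.measurable (by fun_prop)))
  have hs : Measurable fun t : ℝ => ENNReal.ofReal (√(1 - t ^ 2) ^ (n - 2)) :=
    (Continuous.measurable (by fun_prop)).ennreal_ofReal
  rw [interpMeasure, lintegral_prod _ hm.aemeasurable, nu,
    lintegral_withDensity_eq_lintegral_mul _ measurable_psi_inner hk]
  have h1 : ∀ p : Sph n × Sph n, ((fun p : Sph n × Sph n =>
      psi n ⟪(p.1 : Space n), (p.2 : Space n)⟫) * k) p = ENNReal.ofReal (psiConst n) *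
      ∫⁻ t in Set.Ioo (0 : ℝ) 1, ENNReal.ofReal (√(1 - t ^ 2) ^ (n - 2)) *
        (k p * innerPsi n (t * ⟪(p.1 : Space n), (p.2 : Space n)⟫)) := by
    intro p
    rw [Pi.mul_apply, psi_eq, mul_assoc, ← lintegral_mul_const]
    · congr 1
      refine lintegral_congr fun t => ?_
      ring
    · exact hs.mul (measurable_innerPsi.comp (by fun_prop))
  simp_rw [h1]
  rw [lintegral_const_mul' _ _ ENNReal.ofReal_ne_top, lintegral_lintegral_swap
    ((hs.comp measurable_snd).mul hk2).aemeasurable,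
    ← lintegral_const_mul' _ _ ENNReal.ofReal_ne_top]
  refine setLIntegral_congr_fun measurableSet_Ioo fun t ht => ?_
  have h2 : 0 < 1 - t ^ 2 := by nlinarith [ht.1, ht.2]
  have h3 := lintegral_correlated_radial hn e (Real.sqrt_pos.2 h2) (t := t)
    (by rw [Real.sq_sqrt h2.le]; ring) hk
  simp only [weight, interp]
  rw [h3, lintegral_const_mul' _ _ ENNReal.ofReal_ne_top]
  congr 2
  have hk3 : Measurable fun p : Sph n × Sph n =>
      k p * innerPsi n (t * ⟪(p.1 : Space n), (p.2 : Space n)⟫) :=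
    hk2.comp (measurable_id.prodMk measurable_const)
  rw [lintegral_prod _ hk3.aemeasurable]

/-- `ν_n` is the weighted law of the directions of interpolated Gaussian vectors. -/
lemma nu_eq_map (hn : 2 ≤ n) (e : Sph n) : nu n =
    ((interpMeasure n).withDensity fun q => ENNReal.ofReal (weight q)).map
      fun q => (radial e q.2.1, radial e (interp q)) := by
  refine Measure.ext_of_lintegral _ fun k hk => ?_
  have hk2 : Measurable fun q : ℝ × Space n × Space n => k (radial e q.2.1, radial e (interp q)) :=
    hk.comp (measurable_radial_interp e)
  rw [lintegral_map hk (measurable_radial_interp e), lintegral_nu hn e hk,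
    lintegral_withDensity_eq_lintegral_mul _ measurable_weight.ennreal_ofReal hk2]
  refine lintegral_congr fun q => ?_
  simp [mul_comm]

lemma integral_nu (hn : 2 ≤ n) (e : Sph n) {k : Sph n × Sph n → ℝ} (hk : Measurable k) :
    ∫ p, k p ∂(nu n) =
      ∫ q, weight q * k (radial e q.2.1, radial e (interp q)) ∂(interpMeasure n) := by
  rw [nu_eq_map hn e, integral_map (measurable_radial_interp e).aemeasurable
    hk.aestronglyMeasurable, integral_withDensity_eq_integral_toReal_smul
      measurable_weight.ennreal_ofReal (by simp)]
  simp [weight_nonneg]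

/-- By `lintegral_nu` with `k = 1`, the mean weight is the mass of `ν_n`. The weight is the
dominating function in the final limit. -/
lemma integrable_weight (hn : 2 ≤ n) (h : nu n Set.univ ≠ ⊤) :
    Integrable weight (interpMeasure n) := by
  obtain ⟨e⟩ := nonempty_sph (n := n) (by omega)
  refine ⟨measurable_weight.aestronglyMeasurable, ?_⟩
  rw [hasFiniteIntegral_iff_ofReal (Filter.Eventually.of_forall weight_nonneg)]
  have := lintegral_nu hn e (k := fun _ => 1) measurable_const
  simp only [lintegral_one, one_mul] at this
  rw [← this]
  exact h.lt_top

/-- The interpolated vector is a standard Gaussian vector. -/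
lemma map_interp (t : ℝ) (ht : t ∈ Set.Ioo (0 : ℝ) 1) :
    MeasurePreserving (fun p : Space n × Space n => interp (t, p))
      ((stdGaussian (Space n)).prod (stdGaussian (Space n))) (stdGaussian (Space n)) := by
  have h2 : 0 < 1 - t ^ 2 := by nlinarith [ht.1, ht.2]
  exact measurePreserving_fst.comp (measurePreserving_reflect (a := t) (b := √(1 - t ^ 2))
    (by rw [Real.sq_sqrt h2.le]; ring))

lemma lintegral_interp {h : Space n → ℝ≥0∞} (hh : Measurable h) :
    ∫⁻ q, h (interp q) ∂(interpMeasure n) = ∫⁻ x, h x ∂(stdGaussian (Space n)) := by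
  have hh2 : Measurable fun q : ℝ × Space n × Space n => h (interp q) :=
    hh.comp continuous_interp.measurable
  rw [interpMeasure, lintegral_prod _ hh2.aemeasurable,
    setLIntegral_congr_fun measurableSet_Ioo fun t ht => (map_interp t ht).lintegral_comp hh]
  simp

lemma lintegral_fst_interpMeasure {h : Space n → ℝ≥0∞} (hh : Measurable h) :
    ∫⁻ q, h q.2.1 ∂(interpMeasure n) = ∫⁻ x, h x ∂(stdGaussian (Space n)) := by
  exact (measurePreserving_fst.comp measurePreserving_snd).lintegral_comp hh

/-- Both vectors are standard Gaussian and the origin is a null set, so the value `e` of `radial e`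
at the origin never matters. -/
lemma ae_interpMeasure_ne_zero (hn : 1 ≤ n) :
    ∀ᵐ q ∂(interpMeasure n), q.2.1 ≠ 0 ∧ interp q ≠ 0 := by
  have : Nonempty (Fin n) := ⟨⟨0, hn⟩⟩
  have h0 : stdGaussian (Space n) {0} = 0 := stdGaussian_absolutelyContinuous (measure_singleton 0)
  have hm : Measurable (Set.indicator ({0} : Set (Space n)) (1 : Space n → ℝ≥0∞)) :=
    measurable_one.indicator (measurableSet_singleton 0)
  have hm1 : Measurable fun q : ℝ × Space n × Space n =>
      Set.indicator ({0} : Set (Space n)) (1 : Space n → ℝ≥0∞) q.2.1 :=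
    hm.comp (measurable_fst.comp measurable_snd)
  have hm2 : Measurable fun q : ℝ × Space n × Space n =>
      Set.indicator ({0} : Set (Space n)) (1 : Space n → ℝ≥0∞) (interp q) :=
    hm.comp continuous_interp.measurable
  have h1 := lintegral_fst_interpMeasure hm
  have h2 := lintegral_interp hm
  rw [lintegral_indicator_one (measurableSet_singleton 0), h0, lintegral_eq_zero_iff hm1] at h1
  rw [lintegral_indicator_one (measurableSet_singleton 0), h0, lintegral_eq_zero_iff hm2] at h2
  filter_upwards [h1, h2] with q hq1 hq2
  exact ⟨fun h => by simp [h] at hq1, fun h => by simp [h] at hq2⟩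

end Nu

/-! ### Finiteness of `ν_n` for `n ≥ 3`. -/

section Finite

variable {n : ℕ}

lemma lintegral_rpow_mul_exp_lt_top (m : ℕ) {b c : ℝ} (hb : 0 < b) :
    ∫⁻ r in Set.Ioi (0 : ℝ), ENNReal.ofReal (c * (r ^ m * Real.exp (-b * r ^ 2))) < ⊤ := by
  have h : IntegrableOn (fun r : ℝ => c * (r ^ m * Real.exp (-b * r ^ 2))) (Set.Ioi 0) := by
    refine Integrable.const_mul ?_ c
    have h := integrableOn_rpow_mul_exp_neg_mul_sq hb (s := m)
      (by have : (0 : ℝ) ≤ m := by positivity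
          linarith)
    refine h.congr_fun (fun r _ => ?_) measurableSet_Ioi
    simp
  exact h.lintegral_lt_top

/-- In polar coordinates the radial integrand is a multiple of `r^(n-3) exp(-r²/2)`, which is
integrable at `0` precisely because `n ≥ 3`. -/
lemma lintegral_inv_sq_norm_lt_top (hn : 3 ≤ n) :
    ∫⁻ x : Space n, ENNReal.ofReal ((‖x‖ ^ 2)⁻¹) ∂(stdGaussian (Space n)) < ⊤ := by
  have hD : Measurable fun x => ENNReal.ofReal (gaussianDensity (Space n) x) :=
    continuous_gaussianDensity.measurable.ennreal_ofReal
  have hm : Measurable fun x : Space n => ENNReal.ofReal ((‖x‖ ^ 2)⁻¹) := by fun_prop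
  rw [lintegral_stdGaussian _ hm, lintegral_polar (by omega) (f := fun x : Space n =>
    ENNReal.ofReal (gaussianDensity (Space n) x) * ENNReal.ofReal ((‖x‖ ^ 2)⁻¹)) (hD.mul hm)]
  have key : ∀ u : Sph n, ∫⁻ r in Set.Ioi (0 : ℝ), ENNReal.ofReal (r ^ (n - 1)) *
      (ENNReal.ofReal (gaussianDensity (Space n) (r • (u : Space n))) *
        ENNReal.ofReal ((‖r • (u : Space n)‖ ^ 2)⁻¹)) =
      ∫⁻ r in Set.Ioi (0 : ℝ), ENNReal.ofReal
        (((2 * Real.pi) ^ (Module.finrank ℝ (Space n) / 2 : ℝ))⁻¹ *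
          (r ^ (n - 3) * Real.exp (-(1 / 2) * r ^ 2))) := by
    intro u
    refine setLIntegral_congr_fun measurableSet_Ioi fun r hr => ?_
    have hr : 0 < r := hr
    rw [← ENNReal.ofReal_mul (gaussianDensity_pos _).le, ← ENNReal.ofReal_mul (by positivity)]
    congr 1
    rw [gaussianDensity, norm_smul, norm_eq_of_mem_sphere, mul_one, Real.norm_eq_abs,
      abs_of_pos hr, show n - 1 = n - 3 + 2 by omega, pow_add,
      show -r ^ 2 / 2 = -(1 / 2) * r ^ 2 by ring]
    field_simp
  simp_rw [key]
  rw [lintegral_const]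
  exact ENNReal.mul_lt_top (lintegral_rpow_mul_exp_lt_top _ one_half_pos) (measure_lt_top _ _)

/-- The weight is at most `|X|⁻² + |Y|⁻²`, and both `X` and `Y` are standard Gaussian. -/
lemma nu_univ_ne_top_of_three_le (hn : 3 ≤ n) : nu n Set.univ ≠ ⊤ := by
  obtain ⟨e⟩ := nonempty_sph (n := n) (by omega)
  have h := lintegral_nu (by omega) e (k := fun _ => 1) measurable_const
  simp only [lintegral_one, one_mul] at h
  have hm : Measurable fun x : Space n => ENNReal.ofReal ((‖x‖ ^ 2)⁻¹) := by fun_prop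
  rw [h]
  refine ne_top_of_le_ne_top (b := ∫⁻ q, (ENNReal.ofReal ((‖q.2.1‖ ^ 2)⁻¹) +
    ENNReal.ofReal ((‖interp q‖ ^ 2)⁻¹)) ∂(interpMeasure n)) ?_ (lintegral_mono fun q => ?_)
  · have hm2 : Measurable fun q : ℝ × Space n × Space n => ENNReal.ofReal ((‖interp q‖ ^ 2)⁻¹) :=
      hm.comp continuous_interp.measurable
    rw [lintegral_add_right _ hm2, lintegral_interp hm,
      lintegral_fst_interpMeasure hm]
    exact (ENNReal.add_lt_top.2
      ⟨lintegral_inv_sq_norm_lt_top hn, lintegral_inv_sq_norm_lt_top hn⟩).ne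
  · rw [← ENNReal.ofReal_add (by positivity) (by positivity), weight]
    refine ENNReal.ofReal_le_ofReal ?_
    rw [← inv_pow, ← inv_pow]
    nlinarith [sq_nonneg (‖q.2.1‖⁻¹ - ‖interp q‖⁻¹), sq_nonneg (‖q.2.1‖⁻¹ + ‖interp q‖⁻¹)]

end Finite

/-! ### Positivity, finiteness and the planar bound for `ψ_n`. -/

section Psi

variable {n : ℕ}

lemma setLIntegral_pos_of_pos {α : Type*} [MeasurableSpace α] {μ : Measure α} {s : Set α}
    (h0 : μ s ≠ 0) {f : α → ℝ≥0∞} (hf : Measurable f)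
    (hpos : ∀ x ∈ s, 0 < f x) : 0 < ∫⁻ x in s, f x ∂μ := by
  rw [setLIntegral_pos_iff hf]
  have : Function.support f ∩ s = s := Set.inter_eq_right.2 fun x hx => (hpos x hx).ne'
  rw [this]
  exact pos_iff_ne_zero.2 h0

lemma innerPsi_pos (β : ℝ) : 0 < innerPsi n β := by
  set F : ℝ × ℝ → ℝ≥0∞ := fun q => ENNReal.ofReal (Real.exp (-(q.1 ^ 2 + q.2 ^ 2 -
        2 * q.1 * q.2 * β) / 2) * (q.1 * q.2) ^ (n - 2)) with hF
  have hm : Measurable F := (Continuous.measurable (by fun_prop)).ennreal_ofReal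
  have hpos : ∀ r ∈ Set.Ioi (0 : ℝ), 0 < ∫⁻ r' in Set.Ioi (0 : ℝ), F (r, r') := fun r hr =>
    setLIntegral_pos_of_pos (by simp) (hm.comp measurable_prodMk_left) fun r' hr' => by
      have hr : 0 < r := hr
      have hr' : 0 < r' := hr'
      exact ENNReal.ofReal_pos.2 (by positivity)
  exact setLIntegral_pos_of_pos (by simp)
    (hm.lintegral_prod_right' (ν := volume.restrict (Set.Ioi 0))) hpos

lemma psiConst_pos (hn : 1 ≤ n) : 0 < psiConst n := by
  have hn' : (0 : ℝ) < n := by exact_mod_cast hn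
  have := Real.Gamma_pos_of_pos (half_pos hn')
  unfold psiConst
  positivity

lemma psi_pos (hn : 1 ≤ n) (α : ℝ) : 0 < psi n α := by
  rw [psi_eq]
  refine ENNReal.mul_pos (ENNReal.ofReal_pos.2 (psiConst_pos hn)).ne'
    (setLIntegral_pos_of_pos (by simp) ?_ fun t ht => ?_).ne'
  · exact (Continuous.measurable (by fun_prop)).ennreal_ofReal.mul
      (measurable_innerPsi.comp (by fun_prop))
  · have h2 : 0 < 1 - t ^ 2 := by nlinarith [ht.1, ht.2]
    have h3 := Real.sqrt_pos.2 h2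
    exact ENNReal.mul_pos (ENNReal.ofReal_pos.2 (by positivity)).ne' (innerPsi_pos _).ne'

/-- With `a = max α 0 < 1`, the quadratic form satisfies `r² + r'² - 2 r r' t α ≥ (1 - a)(r² + r'²)`
for all `t ∈ (0, 1)`. The double integral is thus bounded by a product of two Gaussian moments,
uniformly in `t`. -/
lemma psi_lt_top {α : ℝ} (hα : α < 1) : psi n α < ⊤ := by
  set a := max α 0 with ha
  have ha1 : a < 1 := max_lt hα one_pos
  have ha0 : 0 ≤ a := le_max_right _ _
  set B : ℝ≥0∞ := ∫⁻ r in Set.Ioi (0 : ℝ),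
    ENNReal.ofReal (1 * (r ^ (n - 2) * Real.exp (-((1 - a) / 2) * r ^ 2))) with hB
  have hBt : B < ⊤ := lintegral_rpow_mul_exp_lt_top _ (by linarith)
  have hI : ∀ t ∈ Set.Ioo (0 : ℝ) 1, innerPsi n (t * α) ≤ B * B := by
    intro t ht
    have hta : t * α ≤ a := by
      rcases le_total α 0 with h | h
      · exact (mul_nonpos_of_nonneg_of_nonpos ht.1.le h).trans ha0
      · exact (mul_le_of_le_one_left h ht.2.le).trans (le_max_left _ _)
    rw [innerPsi]
    conv_rhs => rw [hB, ← lintegral_mul_const' _ _ hBt.ne]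
    refine setLIntegral_mono' measurableSet_Ioi fun r hr => ?_
    rw [hB, ← lintegral_const_mul' _ _ ENNReal.ofReal_ne_top]
    refine setLIntegral_mono' measurableSet_Ioi fun r' hr' => ?_
    have hr : 0 < r := hr
    have hr' : 0 < r' := hr'
    rw [← ENNReal.ofReal_mul (by positivity)]
    refine ENNReal.ofReal_le_ofReal ?_
    have h1 : Real.exp (-(r ^ 2 + r' ^ 2 - 2 * r * r' * (t * α)) / 2) ≤
        Real.exp (-((1 - a) / 2) * r ^ 2) * Real.exp (-((1 - a) / 2) * r' ^ 2) := by
      rw [← Real.exp_add]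
      refine Real.exp_le_exp.2 ?_
      have h2 : r * r' * (t * α) ≤ r * r' * a := by gcongr
      nlinarith [mul_nonneg ha0 (sq_nonneg (r - r'))]
    calc _ ≤ Real.exp (-((1 - a) / 2) * r ^ 2) * Real.exp (-((1 - a) / 2) * r' ^ 2) *
          (r * r') ^ (n - 2) := by gcongr
      _ = _ := by rw [mul_pow]; ring
  rw [psi_eq]
  refine ENNReal.mul_lt_top ENNReal.ofReal_lt_top ?_
  calc ∫⁻ t in Set.Ioo (0 : ℝ) 1, ENNReal.ofReal (√(1 - t ^ 2) ^ (n - 2)) * innerPsi n (t * α)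
      ≤ ∫⁻ t in Set.Ioo (0 : ℝ) 1, 1 * (B * B) := by
        refine setLIntegral_mono' measurableSet_Ioo fun t ht => ?_
        refine mul_le_mul' ?_ (hI t ht)
        rw [ENNReal.ofReal_le_one]
        refine pow_le_one₀ (Real.sqrt_nonneg _) ?_
        exact Real.sqrt_le_one.2 (by nlinarith [sq_nonneg t])
    _ < ⊤ := by
        rw [lintegral_const]
        exact ENNReal.mul_lt_top (ENNReal.mul_lt_top ENNReal.one_lt_top
          (ENNReal.mul_lt_top hBt hBt)) (by simp)

/-- In the plane, the two kernels at opposite correlations add up to a full Gaussian integral. -/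
lemma innerPsi_two_add_neg_le {β : ℝ} (hβ : β ^ 2 < 1) :
    innerPsi 2 β + innerPsi 2 (-β) ≤ ENNReal.ofReal (Real.pi / √(1 - β ^ 2)) := by
  set F : ℝ → ℝ → ℝ≥0∞ := fun r r' =>
    ENNReal.ofReal (Real.exp (-(r ^ 2 + r' ^ 2 - 2 * r * r' * β) / 2)) with hF
  have hFm : Measurable fun q : ℝ × ℝ => F q.1 q.2 :=
    (Continuous.measurable (by fun_prop)).ennreal_ofReal
  have h1 : innerPsi 2 β = ∫⁻ r in Set.Ioi (0 : ℝ), ∫⁻ r' in Set.Ioi (0 : ℝ), F r r' := by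
    simp [innerPsi, hF]
  -- Under `r' ↦ -r'` the kernel at `-β` becomes the integral of the kernel at `β` over the adjacent
  -- quadrant. The two quadrants fill the half-plane `r > 0`, where completing the square in `r'`
  -- separates the variables.
  have h2 : innerPsi 2 (-β) = ∫⁻ r in Set.Ioi (0 : ℝ), ∫⁻ r' in Set.Iio (0 : ℝ), F r r' := by
    simp only [innerPsi, Nat.sub_self, pow_zero, mul_one]
    refine lintegral_congr fun r => ?_
    rw [← lintegral_indicator measurableSet_Iio, ← lintegral_indicator measurableSet_Ioi,
      ← lintegral_neg_eq_self (fun r' => (Set.Iio (0 : ℝ)).indicator _ r')]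
    refine lintegral_congr fun r' => ?_
    by_cases h : 0 < r'
    · simp [Set.indicator, h, hF]
      ring_nf
    · simp [Set.indicator, h]
  have h3 : ∀ r, ∫⁻ r', F r r' =
      ENNReal.ofReal (Real.exp (-((1 - β ^ 2) / 2) * r ^ 2)) * ENNReal.ofReal √(2 * Real.pi) := by
    intro r
    have hint : Integrable fun r' : ℝ => Real.exp (-(1 / 2) * r' ^ 2) :=
      integrable_exp_neg_mul_sq (by norm_num)
    have h4 : ENNReal.ofReal √(2 * Real.pi) =
        ∫⁻ r', ENNReal.ofReal (Real.exp (-(1 / 2) * r' ^ 2)) := by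
      rw [← ofReal_integral_eq_lintegral_ofReal hint
        (Filter.Eventually.of_forall fun x => (Real.exp_pos _).le), integral_gaussian]
      congr 2
      ring
    rw [h4, ← lintegral_add_right_eq_self _ (β * r), ← lintegral_const_mul' _ _
      ENNReal.ofReal_ne_top]
    refine lintegral_congr fun r' => ?_
    rw [← ENNReal.ofReal_mul (Real.exp_pos _).le, ← Real.exp_add]
    simp only [hF]
    ring_nf
  have hb : 0 < 1 - β ^ 2 := by linarith
  have h5 : ∫⁻ r in Set.Ioi (0 : ℝ), ENNReal.ofReal (Real.exp (-((1 - β ^ 2) / 2) * r ^ 2)) =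
      ENNReal.ofReal (√(Real.pi / ((1 - β ^ 2) / 2)) / 2) := by
    rw [← ofReal_integral_eq_lintegral_ofReal
      ((integrable_exp_neg_mul_sq (by positivity)).integrableOn)
        (Filter.Eventually.of_forall fun x => (Real.exp_pos _).le), integral_gaussian_Ioi]
  have hm1 : Measurable fun r => ∫⁻ r' in Set.Ioi (0 : ℝ), F r r' :=
    hFm.lintegral_prod_right' (ν := volume.restrict (Set.Ioi 0))
  calc innerPsi 2 β + innerPsi 2 (-β) ≤ ∫⁻ r in Set.Ioi (0 : ℝ), ∫⁻ r', F r r' := by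
        rw [h1, h2, ← lintegral_add_left hm1]
        refine lintegral_mono fun r => ?_
        have hd : Disjoint (Set.Ioi (0 : ℝ)) (Set.Iio 0) :=
          Set.disjoint_left.2 fun x (hx : 0 < x) (hx' : x < 0) => lt_asymm hx hx'
        rw [← lintegral_union measurableSet_Iio hd]
        exact setLIntegral_le_lintegral _ _
    _ = ENNReal.ofReal (Real.pi / √(1 - β ^ 2)) := by
        simp_rw [h3]
        rw [lintegral_mul_const' _ _ ENNReal.ofReal_ne_top, h5, ← ENNReal.ofReal_mul (by positivity)]
        congr 1
        rw [show Real.pi / ((1 - β ^ 2) / 2) = 2 * Real.pi / (1 - β ^ 2) by field_simp,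
          Real.sqrt_div (by positivity), div_div, div_mul_eq_mul_div,
          Real.mul_self_sqrt (by positivity)]
        field_simp

/-- Since `|α| ≤ 1`, the sum of the kernels is at most `π/√(1 - t²)`, whose integral over `(0, 1)`
is `π · arcsin 1`. The bound remains valid at `α = ±1`. -/
lemma psi_two_add_neg_le {α : ℝ} (hα : α ∈ Set.Icc (-1 : ℝ) 1) :
    psi 2 α + psi 2 (-α) ≤ ENNReal.ofReal (Real.pi ^ 2 / 2) := by
  have hc : psiConst 2 = 1 := by simp [psiConst]
  have hm : Measurable fun t => innerPsi 2 (t * α) := measurable_innerPsi.comp (by fun_prop)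
  have hα2 : α ^ 2 ≤ 1 := by nlinarith [hα.1, hα.2]
  have hder : ∀ t ∈ Set.Ioo (0 : ℝ) 1,
      HasDerivAt (fun t => Real.pi * Real.arcsin t) (Real.pi * (1 / √(1 - t ^ 2))) t := fun t ht =>
    (Real.hasDerivAt_arcsin (by linarith [ht.1]) ht.2.ne).const_mul _
  have hcont : ContinuousOn (fun t => Real.pi * Real.arcsin t) (Set.Icc 0 1) := by
    fun_prop
  have hint := intervalIntegral.integrableOn_deriv_of_nonneg hcont hder
    (fun t _ => by positivity)
  have hval := intervalIntegral.integral_eq_sub_of_hasDerivAt_of_le zero_le_one hcont hder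
    ((intervalIntegrable_iff_integrableOn_Ioc_of_le zero_le_one).2 hint)
  simp only [psi_eq, hc, ENNReal.ofReal_one, one_mul, Nat.sub_self, pow_zero]
  rw [← lintegral_add_left hm]
  calc _ ≤ ∫⁻ t in Set.Ioo (0 : ℝ) 1, ENNReal.ofReal (Real.pi * (1 / √(1 - t ^ 2))) := by
        refine setLIntegral_mono' measurableSet_Ioo fun t ht => ?_
        have h2 : 0 < 1 - t ^ 2 := by nlinarith [ht.1, ht.2]
        have h3 : (t * α) ^ 2 ≤ t ^ 2 := by
          rw [mul_pow]
          exact mul_le_of_le_one_right (sq_nonneg t) hα2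
        have h4 := innerPsi_two_add_neg_le (β := t * α) (by linarith)
        rw [mul_neg]
        refine h4.trans (ENNReal.ofReal_le_ofReal ?_)
        rw [mul_one_div]
        gcongr
    _ = ENNReal.ofReal (Real.pi ^ 2 / 2) := by
        rw [← ofReal_integral_eq_lintegral_ofReal (hint.mono_set Set.Ioo_subset_Ioc_self)
          (Filter.Eventually.of_forall fun x => by positivity),
          ← integral_Ioc_eq_integral_Ioo, ← intervalIntegral.integral_of_le zero_le_one, hval]
        simp only [Real.arcsin_one, Real.arcsin_zero]
        ring_nf

lemma psi_two_le {α : ℝ} (hα : α ∈ Set.Icc (-1 : ℝ) 1) :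
    psi 2 α ≤ ENNReal.ofReal (2 * Real.pi) := by
  refine le_self_add.trans ((psi_two_add_neg_le hα).trans (ENNReal.ofReal_le_ofReal ?_))
  nlinarith [Real.pi_pos, Real.pi_lt_four]

end Psi

/-! ### Rotation invariance, marginals and total mass. -/

section Marginals

variable {n : ℕ}

/-- The uniform distribution on the sphere is invariant under linear isometries. -/
lemma lintegral_sigma_comp_isometry (hn : 1 ≤ n) (L : Space n ≃ₗᵢ[ℝ] Space n)
    {k : Space n → ℝ≥0∞} (hk : Measurable k) :
    ∫⁻ y : Sph n, k (L y) ∂(sigma n) = ∫⁻ y : Sph n, k y ∂(sigma n) := by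
  obtain ⟨e⟩ := nonempty_sph hn
  have : Nonempty (Fin n) := ⟨⟨0, hn⟩⟩
  have hkL : Measurable fun y : Sph n => k (L y) :=
    hk.comp (L.continuous.measurable.comp measurable_subtype_coe)
  have hk' : Measurable fun y : Sph n => k y := hk.comp measurable_subtype_coe
  have hk2 : Measurable fun y : Space n => k (radial e y) := hk'.comp (measurable_radial e)
  have h0 : ∀ᵐ x ∂(stdGaussian (Space n)), x ≠ 0 :=
    stdGaussian_absolutelyContinuous.ae_le (Measure.ae_ne volume 0)
  rw [← map_radial_stdGaussian hn e, lintegral_map hkL (measurable_radial e),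
    lintegral_map hk' (measurable_radial e)]
  conv_rhs => rw [← stdGaussian_map (E := Space n) L]
  rw [lintegral_map hk2 L.continuous.measurable]
  refine lintegral_congr_ae ?_
  filter_upwards [h0] with x hx
  rw [coe_radial e hx, coe_radial e ((map_ne_zero_iff L L.injective).2 hx), L.norm_map, map_smul]

/-- The reflection in the hyperplane orthogonal to `x - x'` carries `x` to `x'` and preserves
`sigma`. Equal slice masses are what make the marginals uniform. -/
lemma lintegral_psi_inner_eq (hn : 1 ≤ n) (x x' : Sph n) :
    ∫⁻ y : Sph n, psi n ⟪(x : Space n), (y : Space n)⟫ ∂(sigma n) =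
      ∫⁻ y : Sph n, psi n ⟪(x' : Space n), (y : Space n)⟫ ∂(sigma n) := by
  set L : Space n ≃ₗᵢ[ℝ] Space n := (ℝ ∙ ((x : Space n) - x'))ᗮ.reflection with hL
  have hLx : L x = x' := Submodule.reflection_sub (by simp)
  rw [← lintegral_sigma_comp_isometry hn L (k := fun y => psi n ⟪(x' : Space n), y⟫)
    (measurable_psi.comp (by fun_prop))]
  simp_rw [← hLx, LinearIsometryEquiv.inner_map_map]

/-- The total mass of the slices of `ν_n`. -/
def mass (n : ℕ) : ℝ≥0∞ := nu n Set.univ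

lemma lintegral_nu_prod {A B : Set (Sph n)} (hA : MeasurableSet A) (hB : MeasurableSet B) :
    nu n (A ×ˢ B) = ∫⁻ x in A, ∫⁻ y in B, psi n ⟪(x : Space n), (y : Space n)⟫
      ∂(sigma n) ∂(sigma n) := by
  rw [nu, withDensity_apply _ (hA.prod hB), ← Measure.prod_restrict,
    lintegral_prod _ measurable_psi_inner.aemeasurable]

lemma lintegral_psi_inner (hn : 1 ≤ n) (x : Sph n) :
    ∫⁻ y : Sph n, psi n ⟪(x : Space n), (y : Space n)⟫ ∂(sigma n) = mass n := by
  have := isProbabilityMeasure_sigma hn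
  have h := lintegral_nu_prod (n := n) MeasurableSet.univ MeasurableSet.univ
  rw [Set.univ_prod_univ, Measure.restrict_univ] at h
  simp_rw [fun x' => lintegral_psi_inner_eq hn x' x] at h
  simpa [mass] using h.symm

lemma map_fst_nu (hn : 1 ≤ n) : (nu n).map Prod.fst = mass n • sigma n := by
  ext A hA
  rw [Measure.map_apply measurable_fst hA, ← Set.prod_univ, lintegral_nu_prod hA MeasurableSet.univ,
    Measure.restrict_univ]
  simp_rw [lintegral_psi_inner hn]
  simp

lemma map_snd_nu (hn : 1 ≤ n) : (nu n).map Prod.snd = mass n • sigma n := by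
  ext A hA
  have hm : Measurable fun p : Sph n × Sph n => psi n ⟪(p.1 : Space n), (p.2 : Space n)⟫ :=
    measurable_psi_inner
  rw [Measure.map_apply measurable_snd hA, ← Set.univ_prod, lintegral_nu_prod MeasurableSet.univ hA,
    Measure.restrict_univ, lintegral_lintegral_swap hm.aemeasurable]
  simp_rw [real_inner_comm, lintegral_psi_inner hn]
  simp

lemma mass_ne_zero (hn : 1 ≤ n) : mass n ≠ 0 := by
  obtain ⟨e⟩ := nonempty_sph hn
  have := isProbabilityMeasure_sigma hn
  rw [← lintegral_psi_inner hn e, ← setLIntegral_univ]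
  exact (setLIntegral_pos_of_pos (by simp) (measurable_psi.comp (by fun_prop))
    fun y _ => psi_pos hn _).ne'

/-- As `y ↦ -y` preserves `sigma`, averaging `ψ₂` at `⟨e, y⟩` or at `-⟨e, y⟩` gives the same mass,
so `psi_two_add_neg_le` can be averaged. -/
lemma mass_two_add_le : mass 2 + mass 2 ≤ ENNReal.ofReal (Real.pi ^ 2 / 2) := by
  obtain ⟨e⟩ := nonempty_sph (n := 2) (by norm_num)
  have := isProbabilityMeasure_sigma (n := 2) (by norm_num)
  have h1 := lintegral_psi_inner (n := 2) (by norm_num) e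
  have h2 := lintegral_sigma_comp_isometry (n := 2) (by norm_num) (LinearIsometryEquiv.neg ℝ)
    (k := fun y => psi 2 ⟪(e : Space 2), y⟫) (measurable_psi.comp (by fun_prop))
  simp only [LinearIsometryEquiv.coe_neg, inner_neg_right, h1] at h2
  calc mass 2 + mass 2 = ∫⁻ y : Sph 2, (psi 2 ⟪(e : Space 2), (y : Space 2)⟫ +
        psi 2 (-⟪(e : Space 2), (y : Space 2)⟫)) ∂(sigma 2) := by
        have hm : Measurable fun y : Sph 2 => psi 2 ⟪(e : Space 2), (y : Space 2)⟫ :=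
          measurable_psi.comp (by fun_prop)
        rw [lintegral_add_left hm, h1, h2]
    _ ≤ ∫⁻ _ : Sph 2, ENNReal.ofReal (Real.pi ^ 2 / 2) ∂(sigma 2) := by
        refine lintegral_mono fun y => ?_
        refine psi_two_add_neg_le (abs_le.1 ?_)
        refine (abs_real_inner_le_norm _ _).trans ?_
        simp
    _ = _ := by simp

lemma mass_ne_top (hn : 2 ≤ n) : mass n ≠ ⊤ := by
  rcases hn.eq_or_lt with rfl | h
  · exact ne_top_of_le_ne_top ENNReal.ofReal_ne_top (le_self_add.trans mass_two_add_le)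
  · exact nu_univ_ne_top_of_three_le h

lemma mass_two_lt : (mass 2).toReal < Real.pi := by
  have h := ENNReal.toReal_mono ENNReal.ofReal_ne_top mass_two_add_le
  rw [ENNReal.toReal_add (mass_ne_top le_rfl) (mass_ne_top le_rfl),
    ENNReal.toReal_ofReal (by positivity)] at h
  nlinarith [Real.pi_pos, Real.pi_lt_four]

lemma isFiniteMeasure_nu (hn : 2 ≤ n) : IsFiniteMeasure (nu n) := ⟨(mass_ne_top hn).lt_top⟩

/-- This gives the strictness of the bounds on `c_n`: a nonnegative continuous function that is
nonzero somewhere has positive integral. -/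
lemma isOpenPosMeasure_nu (hn : 1 ≤ n) : (nu n).IsOpenPosMeasure := by
  have := isOpenPosMeasure_sigma (n := n)
  exact (withDensity_absolutelyContinuous' measurable_psi_inner.aemeasurable
    (Filter.Eventually.of_forall fun p => (psi_pos hn _).ne')).isOpenPosMeasure

end Marginals

/-! ### The degree-zero homogeneous extension and its gradient. -/

section Gradient

variable {n : ℕ}

lemma contDiffAt_comp_radial {f : Sph n → ℝ} (hf : IsC1 f) (e : Sph n) {x : Space n} (hx : x ≠ 0) :
    ContDiffAt ℝ 1 (fun y => f (radial e y)) x := by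
  obtain ⟨hF, hf⟩ := hf
  let U : TopologicalSpace.Opens (Space n) := ⟨{y | y ≠ 0}, isOpen_ne⟩
  have hg : ContMDiff 𝓘(ℝ, Space n) (𝓡 (n - 1)) 1 (fun y : U => radial e y) := by
    have h2 : ContMDiff 𝓘(ℝ, Space n) 𝓘(ℝ, Space n) 1
        (fun y : U => ‖(y : Space n)‖⁻¹ • (y : Space n)) := by
      intro y
      refine contMDiffAt_subtype_iff (f := fun y : Space n => ‖y‖⁻¹ • y).2 ?_
      rw [contMDiffAt_iff_contDiffAt]
      exact ((contDiffAt_norm ℝ y.2).inv (norm_ne_zero_iff.2 y.2)).smul contDiffAt_id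
    have h3 : ∀ y : U, ‖(y : Space n)‖⁻¹ • (y : Space n) ∈ Metric.sphere (0 : Space n) 1 := by
      intro y
      have hy : (y : Space n) ≠ 0 := y.2
      simp [norm_smul, hy]
    refine (h2.codRestrict_sphere (n := n - 1) h3).congr fun y => ?_
    ext1
    exact coe_radial e y.2
  have h3 : ContMDiffAt 𝓘(ℝ, Space n) 𝓘(ℝ, ℝ) 1 (fun y => f (radial e y)) x :=
    contMDiffAt_subtype_iff (x := (⟨x, hx⟩ : U)).1 ((hf.comp hg) ⟨x, hx⟩)
  exact contMDiffAt_iff_contDiffAt.1 h3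

lemma continuous_of_isC1 {f : Sph n → ℝ} (hf : IsC1 f) : Continuous f := by
  obtain ⟨_, hf⟩ := hf
  exact hf.continuous

lemma radial_coe (e u : Sph n) : radial e (u : Space n) = u := by
  simpa using radial_smul e one_pos u

/-- The derivative is the orthogonal projection onto the tangent hyperplane at `u`. -/
lemma hasFDerivAt_radial (e u : Sph n) :
    HasFDerivAt (fun y => (radial e y : Space n))
      (ContinuousLinearMap.id ℝ (Space n) - (innerSL ℝ (u : Space n)).smulRight (u : Space n)) u := by
  have hu : (u : Space n) ≠ 0 := ne_zero_of_mem_unit_sphere u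
  have h1 : HasFDerivAt (fun x : Space n => ‖x‖ ^ 2) (2 • (innerSL ℝ (u : Space n))) u :=
    (hasStrictFDerivAt_norm_sq (u : Space n)).hasFDerivAt
  have h2 : HasFDerivAt (fun x : Space n => ‖x‖) (innerSL ℝ (u : Space n)) u := by
    have := h1.sqrt (by simp)
    simp only [norm_nonneg, Real.sqrt_sq, norm_eq_of_mem_sphere] at this
    convert! this using 1
    ext v
    simp
  have h3 := (((hasDerivAt_inv (norm_ne_zero_iff.2 hu)).comp_hasFDerivAt (u : Space n) h2).smul
    (hasFDerivAt_id (u : Space n)))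
  have h4 : HasFDerivAt (fun y : Space n => ‖y‖⁻¹ • y)
      (ContinuousLinearMap.id ℝ (Space n) -
        (innerSL ℝ (u : Space n)).smulRight (u : Space n)) u := by
    convert! h3 using 1
    ext1 v
    simp [sub_eq_add_neg]
  refine h4.congr_of_eventuallyEq ?_
  filter_upwards [isOpen_ne.mem_nhds hu] with y hy
  exact coe_radial e hy

/-- A chain rule done by hand, since `f` has an expansion only along the sphere: the Taylor
expansion of `f` is composed with the first-order expansion of `radial e`, which projects `w` onto
the tangent hyperplane. -/
lemma hasGradientAt_comp_radial {f : Sph n → ℝ} (e : Sph n) {u : Sph n} {w : Space n}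
    (hw : IsTaylorVector f u w) :
    HasGradientAt (fun y => f (radial e y)) (w - ⟪w, (u : Space n)⟫ • (u : Space n)) u := by
  have hd := hasFDerivAt_radial e u
  have ht : Filter.Tendsto (radial e) (𝓝 (u : Space n)) (𝓝 u) := by
    rw [tendsto_subtype_rng]
    simpa [radial_coe] using hd.continuousAt.tendsto
  have h1 := hw.comp_tendsto ht
  have h2 := h1.trans_isBigO (by simpa [Function.comp_def, radial_coe] using hd.isBigO_sub)
  have h3 := (((innerSL ℝ w).hasFDerivAt (x := (radial e u : Space n))).comp
    (u : Space n) hd).isLittleO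
  rw [hasGradientAt_iff_isLittleO]
  refine (h2.add h3).congr_left fun y => ?_
  simp [radial_coe, inner_sub_left, inner_sub_right, inner_smul_left]
  ring

/-- All Taylor vectors share one tangential projection, the gradient of the extension. The
projection of the shortest vector `w₀` is again a Taylor vector, of squared length `|w₀|² - ⟨w₀,
u⟩²`, so minimality forces `w₀` to be tangential. -/
lemma sphericalGradient_eq {f : Sph n → ℝ} (hf : IsC1 f) {u : Sph n} {w : Space n}
    (hw : IsTaylorVector f u w) :
    sphericalGradient f u = w - ⟪w, (u : Space n)⟫ • (u : Space n) := by
  obtain ⟨h1, h2⟩ := isSphericalGradient_sphericalGradient hf u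
  set w₀ := sphericalGradient f u with hw₀
  have hg0 := hasGradientAt_comp_radial u h1
  rw [(hasGradientAt_comp_radial u hw).unique hg0]
  have hT : IsTaylorVector f u (w₀ - ⟪w₀, (u : Space n)⟫ • (u : Space n)) := by
    have h4 := (hasGradientAt_iff_isLittleO.1 hg0).comp_tendsto
      (continuous_subtype_val.tendsto u)
    simpa [IsTaylorVector, Function.comp_def, radial_coe] using h4
  have h3 := h2 _ hT
  have h4 : ‖w₀ - ⟪w₀, (u : Space n)⟫ • (u : Space n)‖ ^ 2 =
      ‖w₀‖ ^ 2 - ⟪w₀, (u : Space n)⟫ ^ 2 := by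
    rw [norm_sub_sq_real, inner_smul_right, norm_smul, norm_eq_of_mem_sphere, mul_one,
      Real.norm_eq_abs, sq_abs]
    ring
  have h5 : ⟪w₀, (u : Space n)⟫ = 0 := by
    have := pow_le_pow_left₀ (norm_nonneg _) h3 2
    nlinarith
  simp [h5]

lemma gradient_comp_radial_coe {f : Sph n → ℝ} (hf : IsC1 f) (e u : Sph n) :
    gradient (fun y => f (radial e y)) (u : Space n) = sphericalGradient f u := by
  obtain ⟨w, hw⟩ := exists_isTaylorVector hf u
  rw [sphericalGradient_eq hf hw, (hasGradientAt_comp_radial e hw).gradient]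

lemma gradient_comp_smul {E : Type*} [NormedAddCommGroup E] [InnerProductSpace ℝ E]
    [CompleteSpace E] (F : E → ℝ) (c : ℝ) (x : E) :
    gradient (fun y => F (c • y)) x = c • gradient F (c • x) := by
  simp only [gradient, fderiv_comp_smul, map_smul]

/-- The gradient of a function homogeneous of degree `0` is homogeneous of degree `-1`; this reduces
the claim to the sphere. -/
lemma gradient_comp_radial {f : Sph n → ℝ} (hf : IsC1 f) (e : Sph n) {x : Space n} (hx : x ≠ 0) :
    gradient (fun y => f (radial e y)) x = ‖x‖⁻¹ • sphericalGradient f (radial e x) := by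
  have hx' : 0 < ‖x‖⁻¹ := by positivity
  rw [← gradient_comp_radial_coe hf e, coe_radial e hx, ← gradient_comp_smul]
  simp_rw [radial_smul' e hx']

lemma continuousOn_gradient_comp_radial {f : Sph n → ℝ} (hf : IsC1 f) (e : Sph n) :
    ContinuousOn (gradient fun y => f (radial e y)) {0}ᶜ := by
  have h : ContDiffOn ℝ 1 (fun y => f (radial e y)) {0}ᶜ := fun x hx =>
    (contDiffAt_comp_radial hf e hx).contDiffWithinAt
  exact (InnerProductSpace.toDual ℝ (Space n)).symm.continuous.comp_continuousOn
    (h.continuousOn_fderiv_of_isOpen isOpen_compl_singleton (by simp))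

lemma continuous_sphericalGradient {f : Sph n → ℝ} (hf : IsC1 f) :
    Continuous (sphericalGradient f) := by
  rcases isEmpty_or_nonempty (Sph n) with h | ⟨⟨e⟩⟩
  · exact continuous_of_const fun x => (h.false x).elim
  have h := (continuousOn_gradient_comp_radial hf e).comp_continuous
    (continuous_subtype_val (p := fun x => x ∈ Metric.sphere (0 : Space n) 1))
    fun u => ne_zero_of_mem_unit_sphere u
  refine h.congr fun u => gradient_comp_radial_coe hf e u

lemma exists_bound_of_continuous {X : Type*} [NormedAddCommGroup X] {f : Sph n → X}
    (hf : Continuous f) : ∃ C, ∀ u, ‖f u‖ ≤ C := by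
  obtain ⟨C, hC⟩ := isCompact_univ.exists_bound_of_continuousOn hf.continuousOn
  exact ⟨C, fun u => hC u trivial⟩

/-- A `C¹` function on the sphere extends to a `C¹` function on the whole space which is
homogeneous of degree zero away from the origin. -/
lemma exists_regular_extension {f : Sph n → ℝ} (hf : IsC1 f) (e : Sph n) :
    ∃ (H : Space n → ℝ) (C : ℝ), ContDiff ℝ 1 H ∧ (∀ y, |H y| ≤ C) ∧
      (∀ y, ‖gradient H y‖ ≤ C) ∧ (∀ y, ‖gradient H y‖ * ‖y‖ ≤ C) ∧
      ∀ y, 2 < ‖y‖ → H y = f (radial e y) ∧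
        gradient H y = ‖y‖⁻¹ • sphericalGradient f (radial e y) := by
  -- The cutoff vanishes for `|y| ≤ 1`, which removes the singularity, and is `1` for `|y|² ≥ 2`,
  -- hence near every point with `|y| > 2`.
  set H : Space n → ℝ := fun y => Real.smoothTransition (‖y‖ ^ 2 - 1) * f (radial e y) with hH
  have hHc : ContDiff ℝ 1 H := by
    rw [contDiff_iff_contDiffAt]
    intro x
    by_cases hx : x = 0
    · have h0 : ContDiffAt ℝ 1 (fun _ : Space n => (0 : ℝ)) x := contDiffAt_const
      refine h0.congr_of_eventuallyEq ?_
      have h1 : ∀ᶠ y : Space n in 𝓝 x, ‖y‖ < 1 :=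
        (isOpen_lt continuous_norm continuous_const).mem_nhds (by simp [hx])
      filter_upwards [h1] with y hy
      simp only [hH]
      rw [Real.smoothTransition.zero_of_nonpos (by nlinarith [norm_nonneg y]), zero_mul]
    · exact (Real.smoothTransition.contDiff.contDiffAt.comp x
        ((contDiff_norm_sq ℝ).sub contDiff_const).contDiffAt).mul (contDiffAt_comp_radial hf e hx)
  have hfar : ∀ y, 2 < ‖y‖ → H y = f (radial e y) := by
    intro y hy
    simp only [hH]
    rw [Real.smoothTransition.one_of_one_le (by nlinarith), one_mul]
  have hfar' : ∀ y, 2 < ‖y‖ → gradient H y = ‖y‖⁻¹ • sphericalGradient f (radial e y) := by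
    intro y hy
    have hy0 : y ≠ 0 := by
      rintro rfl
      simp at hy
      linarith
    rw [← gradient_comp_radial hf e hy0]
    refine Filter.EventuallyEq.gradient_eq ?_
    filter_upwards [(isOpen_lt continuous_const continuous_norm).mem_nhds hy] with z hz
    exact hfar z hz
  obtain ⟨C₁, h₁⟩ := exists_bound_of_continuous (continuous_of_isC1 hf)
  obtain ⟨C₂, h₂⟩ := exists_bound_of_continuous (continuous_sphericalGradient hf)
  obtain ⟨C₃, h₃⟩ := (isCompact_closedBall (0 : Space n) 2).exists_bound_of_continuousOn
    (continuous_gradient hHc).continuousOn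
  have hC₂ : 0 ≤ C₂ := (norm_nonneg _).trans (h₂ e)
  have hC₃ : 0 ≤ C₃ := (norm_nonneg _).trans (h₃ 0 (by simp))
  refine ⟨H, C₁ + C₂ + 2 * C₃, hHc, fun y => ?_, fun y => ?_, fun y => ?_, fun y hy =>
    ⟨hfar y hy, hfar' y hy⟩⟩
  · have h4 : |H y| ≤ C₁ := by
      simp only [hH, abs_mul, abs_of_nonneg (Real.smoothTransition.nonneg _)]
      exact (mul_le_of_le_one_left (abs_nonneg _) (Real.smoothTransition.le_one _)).trans (h₁ _)
    linarith
  · have hC₁ : 0 ≤ C₁ := (norm_nonneg _).trans (h₁ e)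
    rcases le_or_gt ‖y‖ 2 with hy | hy
    · have := h₃ y (by simpa using hy)
      linarith
    · rw [hfar' y hy, norm_smul, norm_inv, norm_norm]
      have h5 : ‖y‖⁻¹ ≤ 1 := inv_le_one_of_one_le₀ (by linarith)
      have := mul_le_of_le_one_left (norm_nonneg (sphericalGradient f (radial e y))) h5
      have := h₂ (radial e y)
      linarith
  · have hC₁ : 0 ≤ C₁ := (norm_nonneg _).trans (h₁ e)
    rcases le_or_gt ‖y‖ 2 with hy | hy
    · have := h₃ y (by simpa using hy)
      have := mul_le_mul this hy (norm_nonneg y) hC₃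
      linarith
    · rw [hfar' y hy, norm_smul, norm_inv, norm_norm, mul_right_comm, inv_mul_cancel₀ (by linarith),
        one_mul]
      have := h₂ (radial e y)
      linarith

end Gradient

/-! ### Passage from Gaussian space to the sphere. -/

section Representation

variable {n : ℕ}

lemma integral_sigma_eq (hn : 1 ≤ n) (e : Sph n) {f : Sph n → ℝ} (hf : Continuous f) :
    ∫ x, f (radial e x) ∂(stdGaussian (Space n)) = ∫ u, f u ∂(sigma n) := by
  rw [← map_radial_stdGaussian hn e, integral_map (measurable_radial e).aemeasurable
    hf.aestronglyMeasurable]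

lemma gaussian_covariance_interp {F G : Space n → ℝ} (hF : ContDiff ℝ 1 F) (hG : ContDiff ℝ 1 G)
    {C : ℝ} (hFb : ∀ x, |F x| ≤ C) (hGb : ∀ x, |G x| ≤ C) (hFb' : ∀ x, ‖gradient F x‖ ≤ C)
    (hGb' : ∀ x, ‖gradient G x‖ ≤ C) :
    ∫ x, F x * G x ∂(stdGaussian (Space n)) -
        (∫ x, F x ∂(stdGaussian (Space n))) * ∫ x, G x ∂(stdGaussian (Space n)) =
      ∫ q, ⟪gradient F q.2.1, gradient G (interp q)⟫ ∂(interpMeasure n) := by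
  have hcF := continuous_gradient hF
  have hcG := continuous_gradient hG
  have hci := continuous_interp (n := n)
  have hC : 0 ≤ C := (norm_nonneg _).trans (hFb' 0)
  have hint : Integrable (fun q : ℝ × Space n × Space n =>
      ⟪gradient F q.2.1, gradient G (interp q)⟫) (interpMeasure n) := by
    refine Integrable.mono' (integrable_const (C * C))
      (Continuous.aestronglyMeasurable (by fun_prop)) (Filter.Eventually.of_forall fun q => ?_)
    exact (norm_inner_le_norm _ _).trans (mul_le_mul (hFb' _) (hGb' _) (norm_nonneg _) hC)
  rw [gaussian_covariance hF hG hFb hGb hFb' hGb', intervalIntegral.integral_of_le zero_le_one,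
    integral_Ioc_eq_integral_Ioo, interpMeasure, integral_prod _ hint]
  rfl

/-- The rescalings `x ↦ H (k x)` of the regular extension of `f` approximate the extension of `f`
which is homogeneous of degree zero. -/
lemma exists_regularization {f : Sph n → ℝ} (hf : IsC1 f) (e : Sph n) :
    ∃ (F : ℕ → Space n → ℝ) (C : ℝ), (∀ k, ContDiff ℝ 1 (F k)) ∧ (∀ k x, |F k x| ≤ C) ∧
      (∀ k, ∃ B, ∀ x, ‖gradient (F k) x‖ ≤ B) ∧ (∀ k x, x ≠ 0 → ‖gradient (F k) x‖ ≤ C * ‖x‖⁻¹) ∧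
      ∀ x, x ≠ 0 → ∀ᶠ k in Filter.atTop, F k x = f (radial e x) ∧
        gradient (F k) x = ‖x‖⁻¹ • sphericalGradient f (radial e x) := by
  obtain ⟨H, C, hH, hb, hg, hg', hfar⟩ := exists_regular_extension hf e
  have hk : ∀ k : ℕ, (0 : ℝ) < k + 1 := fun k => by positivity
  -- The bound on `|∇H(y)| |y|` is scale invariant, so `|∇F_k(x)| ≤ C/|x|` uniformly in `k`. The
  -- factor `k + 1` is positive also at `k = 0`, and for fixed `x ≠ 0` it eventually pushes the
  -- argument beyond radius `2`.
  refine ⟨fun k x => H (((k : ℝ) + 1) • x), C, fun k => hH.comp (contDiff_const_smul _),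
    fun k x => hb _, fun k => ⟨(k + 1) * C, fun x => ?_⟩, fun k x hx => ?_, fun x hx => ?_⟩
  · rw [gradient_comp_smul, norm_smul, Real.norm_eq_abs, abs_of_pos (hk k)]
    exact mul_le_mul_of_nonneg_left (hg _) (hk k).le
  · have hx' : 0 < ‖x‖ := norm_pos_iff.2 hx
    have := hg' (((k : ℝ) + 1) • x)
    rw [gradient_comp_smul, norm_smul, ← div_eq_mul_inv, le_div_iff₀ hx']
    rw [norm_smul] at this
    linarith
  · have hx' : 0 < ‖x‖ := norm_pos_iff.2 hx
    have h1 : Filter.Tendsto (fun k : ℕ => ((k : ℝ) + 1) * ‖x‖) Filter.atTop Filter.atTop :=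
      (Filter.tendsto_atTop_add_const_right _ _ tendsto_natCast_atTop_atTop).atTop_mul_const hx'
    filter_upwards [h1.eventually_gt_atTop 2] with k hk2
    have h2 : ‖((k : ℝ) + 1) • x‖ = (k + 1) * ‖x‖ := by
      rw [norm_smul, Real.norm_eq_abs, abs_of_pos (hk k)]
    obtain ⟨h3, h4⟩ := hfar (((k : ℝ) + 1) • x) (by rwa [h2])
    rw [radial_smul' e (hk k)] at h3 h4
    refine ⟨h3, ?_⟩
    rw [gradient_comp_smul, h4, h2, smul_smul]
    congr 1
    have := hk k
    field_simp

lemma tendsto_integral_of_eventually_eq {α : Type*} [MeasurableSpace α] {μ : Measure α}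
    {F : ℕ → α → ℝ} {G b : α → ℝ} (hF : ∀ k, AEStronglyMeasurable (F k) μ) (hb : Integrable b μ)
    (hFb : ∀ k, ∀ᵐ x ∂μ, ‖F k x‖ ≤ b x) (h : ∀ᵐ x ∂μ, ∀ᶠ k in Filter.atTop, F k x = G x) :
    Filter.Tendsto (fun k => ∫ x, F k x ∂μ) Filter.atTop (𝓝 (∫ x, G x ∂μ)) :=
  tendsto_integral_of_dominated_convergence b hF hb hFb
    (h.mono fun _ hx => tendsto_const_nhds.congr' (hx.mono fun _ hk => hk.symm))

/-- The covariance representation on the sphere. -/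
theorem integral_mul_sub_eq_integral_nu (hn : 2 ≤ n) {f g : Sph n → ℝ} (hf : IsC1 f)
    (hg : IsC1 g) :
    ∫ u, f u * g u ∂(sigma n) - (∫ u, f u ∂(sigma n)) * ∫ u, g u ∂(sigma n) =
      ∫ p : Sph n × Sph n, ⟪sphericalGradient f p.1, sphericalGradient g p.2⟫ ∂(nu n) := by
  obtain ⟨e⟩ := nonempty_sph (n := n) (by omega)
  have hn1 : 1 ≤ n := by omega
  have : Nonempty (Fin n) := ⟨⟨0, hn1⟩⟩
  have hfc := continuous_of_isC1 hf
  have hgc := continuous_of_isC1 hg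
  have hsf := continuous_sphericalGradient hf
  have hsg := continuous_sphericalGradient hg
  obtain ⟨F, Cf, hF, hFb, hFB, hFg, hFl⟩ := exists_regularization hf e
  obtain ⟨G, Cg, hG, hGb, hGB, hGg, hGl⟩ := exists_regularization hg e
  have hCf : 0 ≤ Cf := (abs_nonneg _).trans (hFb 0 0)
  have hCg : 0 ≤ Cg := (abs_nonneg _).trans (hGb 0 0)
  have h0 : ∀ᵐ x ∂(stdGaussian (Space n)), x ≠ 0 :=
    stdGaussian_absolutelyContinuous.ae_le (Measure.ae_ne volume 0)
  have hk : ∀ k, ∫ x, F k x * G k x ∂(stdGaussian (Space n)) -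
        (∫ x, F k x ∂(stdGaussian (Space n))) * ∫ x, G k x ∂(stdGaussian (Space n)) =
      ∫ q, ⟪gradient (F k) q.2.1, gradient (G k) (interp q)⟫ ∂(interpMeasure n) := by
    intro k
    obtain ⟨B, hB⟩ := hFB k
    obtain ⟨B', hB'⟩ := hGB k
    have hB0 : 0 ≤ B := (norm_nonneg _).trans (hB 0)
    have hB0' : 0 ≤ B' := (norm_nonneg _).trans (hB' 0)
    refine gaussian_covariance_interp (hF k) (hG k) (C := Cf + Cg + B + B') (fun x => ?_)
      (fun x => ?_) (fun x => ?_) fun x => ?_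
    · linarith [hFb k x]
    · linarith [hGb k x]
    · linarith [hB x]
    · linarith [hB' x]
  have hl1 := tendsto_integral_of_eventually_eq (μ := stdGaussian (Space n))
    (F := fun k x => F k x * G k x) (G := fun x => f (radial e x) * g (radial e x))
    (b := fun _ => Cf * Cg)
    (fun k => ((hF k).continuous.mul (hG k).continuous).aestronglyMeasurable)
    (integrable_const _)
    (fun k => Filter.Eventually.of_forall fun x => by
      rw [norm_mul]
      exact mul_le_mul (hFb k x) (hGb k x) (norm_nonneg _) hCf)
    (h0.mono fun x hx => by
      filter_upwards [hFl x hx, hGl x hx] with k h1 h2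
      rw [h1.1, h2.1])
  have hl2 := tendsto_integral_of_eventually_eq (μ := stdGaussian (Space n))
    (F := F) (G := fun x => f (radial e x)) (b := fun _ => Cf)
    (fun k => (hF k).continuous.aestronglyMeasurable) (integrable_const _)
    (fun k => Filter.Eventually.of_forall fun x => hFb k x)
    (h0.mono fun x hx => (hFl x hx).mono fun k h1 => h1.1)
  have hl3 := tendsto_integral_of_eventually_eq (μ := stdGaussian (Space n))
    (F := G) (G := fun x => g (radial e x)) (b := fun _ => Cg)
    (fun k => (hG k).continuous.aestronglyMeasurable) (integrable_const _)
    (fun k => Filter.Eventually.of_forall fun x => hGb k x)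
    (h0.mono fun x hx => (hGl x hx).mono fun k h1 => h1.1)
  have hae := ae_interpMeasure_ne_zero hn1
  -- The global gradient bounds may grow with `k`, so domination uses `C/|x|` instead, which
  -- produces a multiple of the integrable `weight`.
  have hl4 := tendsto_integral_of_eventually_eq (μ := interpMeasure n)
    (F := fun k q => ⟪gradient (F k) q.2.1, gradient (G k) (interp q)⟫)
    (G := fun q => weight q *
      ⟪sphericalGradient f (radial e q.2.1), sphericalGradient g (radial e (interp q))⟫)
    (b := fun q => Cf * Cg * weight q)
    (fun k => by
      have h1 := continuous_gradient (hF k)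
      have h2 := continuous_gradient (hG k)
      have h3 := continuous_interp (n := n)
      exact Continuous.aestronglyMeasurable (by fun_prop))
    ((integrable_weight hn (mass_ne_top hn)).const_mul _)
    (fun k => hae.mono fun q hq => by
      refine (norm_inner_le_norm _ _).trans ((mul_le_mul (hFg k _ hq.1) (hGg k _ hq.2)
        (norm_nonneg _) (by positivity)).trans (le_of_eq ?_))
      rw [weight]
      ring)
    (hae.mono fun q hq => by
      filter_upwards [hFl _ hq.1, hGl _ hq.2] with k h1 h2
      rw [h1.2, h2.2, real_inner_smul_left, real_inner_smul_right, weight]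
      ring)
  have hm : Measurable fun p : Sph n × Sph n =>
      ⟪sphericalGradient f p.1, sphericalGradient g p.2⟫ :=
    Continuous.measurable (by fun_prop)
  rw [integral_nu hn e hm, ← integral_sigma_eq hn1 e hfc, ← integral_sigma_eq hn1 e hgc,
    ← integral_sigma_eq hn1 e (show Continuous fun u => f u * g u from hfc.mul hgc)]
  refine tendsto_nhds_unique (hl1.sub (hl2.mul hl3)) ?_
  simp_rw [hk]
  exact hl4

lemma integrable_inner_sphericalGradient (hn : 2 ≤ n) {f g : Sph n → ℝ} (hf : IsC1 f)
    (hg : IsC1 g) : Integrable (fun p : Sph n × Sph n =>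
        ⟪sphericalGradient f p.1, sphericalGradient g p.2⟫) (nu n) := by
  have := isFiniteMeasure_nu hn
  have hsf := continuous_sphericalGradient hf
  have hsg := continuous_sphericalGradient hg
  exact Continuous.integrable_of_hasCompactSupport (by fun_prop)
    (HasCompactSupport.of_compactSpace _)

lemma covariance_sigma (hn : 1 ≤ n) {f g : Sph n → ℝ} (hf : Continuous f) (hg : Continuous g) :
    cov[f, g; sigma n] =
      ∫ u, f u * g u ∂(sigma n) - (∫ u, f u ∂(sigma n)) * ∫ u, g u ∂(sigma n) := by
  have := isProbabilityMeasure_sigma hn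
  obtain ⟨C, hC⟩ := exists_bound_of_continuous hf
  obtain ⟨C', hC'⟩ := exists_bound_of_continuous hg
  exact covariance_eq_sub (MemLp.of_bound hf.aestronglyMeasurable C (.of_forall hC))
    (MemLp.of_bound hg.aestronglyMeasurable C' (.of_forall hC'))

end Representation

/-! ### The constant `c_n` from the coordinate functions. -/

section Mass

variable {n : ℕ}

/-- A coordinate function on the sphere. -/
def coord (i : Fin n) (u : Sph n) : ℝ := (u : Space n) i

lemma isC1_coord (hn : 1 ≤ n) (i : Fin n) : IsC1 (coord i) := by
  have hF : Fact (Module.finrank ℝ (Space n) = (n - 1) + 1) :=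
    ⟨by rw [finrank_euclideanSpace, Fintype.card_fin]; omega⟩
  refine ⟨hF, ?_⟩
  exact ((EuclideanSpace.proj (𝕜 := ℝ) i).contMDiff).comp contMDiff_coe_sphere

lemma isTaylorVector_coord (i : Fin n) (u : Sph n) :
    IsTaylorVector (coord i) u (EuclideanSpace.single i 1) := by
  simp [IsTaylorVector, coord, EuclideanSpace.inner_single_left]

/-- The gradients are the tangential projections of the basis vectors, so the sum is the trace of
the product of the projections orthogonal to `u` and to `v`. -/
lemma sum_inner_sphericalGradient_coord (hn : 1 ≤ n) (u v : Sph n) :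
    ∑ i, ⟪sphericalGradient (coord i) u, sphericalGradient (coord i) v⟫ =
      n - 2 + ⟪(u : Space n), (v : Space n)⟫ ^ 2 := by
  have h : ∀ i, ⟪sphericalGradient (coord i) u, sphericalGradient (coord i) v⟫ =
      1 - (v : Space n) i * (v : Space n) i - (u : Space n) i * (u : Space n) i +
        (v : Space n) i * (u : Space n) i * ⟪(u : Space n), (v : Space n)⟫ := by
    intro i
    rw [sphericalGradient_eq (isC1_coord hn i) (isTaylorVector_coord i u),
      sphericalGradient_eq (isC1_coord hn i) (isTaylorVector_coord i v)]
    simp [inner_sub_left, inner_sub_right, real_inner_smul_left, real_inner_smul_right,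
      EuclideanSpace.inner_single_left, EuclideanSpace.inner_single_right]
    ring
  have hsum : ∀ x y : Space n, ∑ i, y i * x i = ⟪x, y⟫ := fun x y => by
    simp [PiLp.inner_apply]
  simp_rw [h]
  rw [Finset.sum_add_distrib, Finset.sum_sub_distrib, Finset.sum_sub_distrib, ← Finset.sum_mul,
    hsum, hsum, hsum]
  simp
  ring

lemma integral_sigma_coord (hn : 1 ≤ n) (i : Fin n) : ∫ u, coord i u ∂(sigma n) = 0 := by
  have : Nonempty (Fin n) := ⟨i⟩
  obtain ⟨e⟩ := nonempty_sph hn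
  have hc := continuous_of_isC1 (isC1_coord hn i)
  have h0 : ∀ᵐ x ∂(stdGaussian (Space n)), x ≠ 0 :=
    stdGaussian_absolutelyContinuous.ae_le (Measure.ae_ne volume 0)
  have h1 : ∫ x, coord i (radial e x) ∂(stdGaussian (Space n)) =
      ∫ x, coord i (radial e (-x)) ∂(stdGaussian (Space n)) := by
    have h2 := stdGaussian_map (E := Space n) (LinearIsometryEquiv.neg ℝ)
    have hm : Measurable fun x => coord i (radial e x) := hc.measurable.comp (measurable_radial e)
    conv_lhs => rw [← h2]
    rw [integral_map (LinearIsometryEquiv.neg ℝ).continuous.aemeasurable hm.aestronglyMeasurable]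
    rfl
  have h3 : ∫ x, coord i (radial e (-x)) ∂(stdGaussian (Space n)) =
      -∫ x, coord i (radial e x) ∂(stdGaussian (Space n)) := by
    rw [← integral_neg]
    refine integral_congr_ae ?_
    filter_upwards [h0] with x hx
    simp [coord, coe_radial e hx, coe_radial e (neg_ne_zero.2 hx)]
  rw [← integral_sigma_eq hn e hc]
  linarith

/-- The covariance representation applied to the coordinate functions. -/
lemma mass_mul_add_integral (hn : 2 ≤ n) :
    ((n : ℝ) - 2) * (mass n).toReal +
      ∫ p : Sph n × Sph n, ⟪(p.1 : Space n), (p.2 : Space n)⟫ ^ 2 ∂(nu n) = 1 := by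
  have hn1 : 1 ≤ n := by omega
  have := isFiniteMeasure_nu hn
  have := isProbabilityMeasure_sigma hn1
  have h1 : ∀ i : Fin n, ∫ u, coord i u * coord i u ∂(sigma n) = ∫ p : Sph n × Sph n,
      ⟪sphericalGradient (coord i) p.1, sphericalGradient (coord i) p.2⟫ ∂(nu n) := fun i => by
    rw [← integral_mul_sub_eq_integral_nu hn (isC1_coord hn1 i) (isC1_coord hn1 i),
      integral_sigma_coord hn1]
    simp
  -- The coordinates have mean zero, so this is the sum of their variances, equal to the mean of
  -- `|u|² = 1`.
  have h2 : ∑ i : Fin n, ∫ u, coord i u * coord i u ∂(sigma n) = 1 := by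
    rw [← integral_finsetSum]
    · have h3 : ∀ u : Sph n, ∑ i, coord i u * coord i u = 1 := fun u => by
        have := EuclideanSpace.real_norm_sq_eq (u : Space n)
        rw [norm_eq_of_mem_sphere] at this
        simp only [coord, ← pow_two, ← this, one_pow]
      simp [h3]
    · intro i _
      have := continuous_of_isC1 (isC1_coord hn1 i)
      exact Continuous.integrable_of_hasCompactSupport (by fun_prop)
        (HasCompactSupport.of_compactSpace _)
  simp_rw [h1] at h2
  rw [← integral_finsetSum _ fun i _ =>
    integrable_inner_sphericalGradient hn (isC1_coord hn1 i) (isC1_coord hn1 i)] at h2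
  simp_rw [sum_inner_sphericalGradient_coord hn1] at h2
  rw [integral_add (integrable_const _) (Continuous.integrable_of_hasCompactSupport (by fun_prop)
    (HasCompactSupport.of_compactSpace _)), integral_const] at h2
  rw [smul_eq_mul, mul_comm] at h2
  exact h2

lemma integral_inner_sq_pos (hn : 2 ≤ n) :
    0 < ∫ p : Sph n × Sph n, ⟪(p.1 : Space n), (p.2 : Space n)⟫ ^ 2 ∂(nu n) := by
  obtain ⟨e⟩ := nonempty_sph (n := n) (by omega)
  have := isFiniteMeasure_nu hn
  have := isOpenPosMeasure_nu (n := n) (by omega)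
  exact Continuous.integral_pos_of_hasCompactSupport_nonneg_nonzero (x := (e, e)) (by fun_prop)
    (HasCompactSupport.of_compactSpace _) (fun p => sq_nonneg _) (by simp)

lemma integral_inner_sq_lt (hn : 2 ≤ n) :
    ∫ p : Sph n × Sph n, ⟪(p.1 : Space n), (p.2 : Space n)⟫ ^ 2 ∂(nu n) < (mass n).toReal := by
  have := isFiniteMeasure_nu hn
  have := isOpenPosMeasure_nu (n := n) (by omega)
  -- An orthogonal pair, available since `n ≥ 2`: there `1 - ⟨x, y⟩²` equals `1`, so its integral is
  -- positive.
  set a : Sph n := ⟨EuclideanSpace.single ⟨0, by omega⟩ 1, by simp⟩ with ha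
  set b : Sph n := ⟨EuclideanSpace.single ⟨1, by omega⟩ 1, by simp⟩ with hb
  have hab : ⟪(a : Space n), (b : Space n)⟫ = 0 := by
    simp [ha, hb, EuclideanSpace.inner_single_left]
  have h : 0 < ∫ p : Sph n × Sph n, (1 - ⟪(p.1 : Space n), (p.2 : Space n)⟫ ^ 2) ∂(nu n) := by
    refine Continuous.integral_pos_of_hasCompactSupport_nonneg_nonzero (x := (a, b)) (by fun_prop)
      (HasCompactSupport.of_compactSpace _) (fun p => ?_) (by simp [hab])
    have h1 := abs_real_inner_le_norm (p.1 : Space n) (p.2 : Space n)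
    simp only [norm_eq_of_mem_sphere, mul_one] at h1
    have h2 := (sq_le_one_iff_abs_le_one _).2 h1
    simpa using h2
  rw [integral_sub (integrable_const _) (Continuous.integrable_of_hasCompactSupport (by fun_prop)
    (HasCompactSupport.of_compactSpace _)), integral_const] at h
  simp only [smul_eq_mul, mul_one] at h
  have h3 : (nu n).real Set.univ = (mass n).toReal := rfl
  linarith

end Mass

end SphereCov

end

open SphereCov in
theorem theorem1p1 (n : ℕ) (hn : 2 ≤ n) :
    -- `ψ_n` is positive on `[-1, 1]` and finite on `[-1, 1)`
    (∀ α ∈ Set.Icc (-1 : ℝ) 1, 0 < psi n α) ∧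
    (∀ α ∈ Set.Ico (-1 : ℝ) 1, psi n α < ⊤) ∧
    (n = 2 → ∀ α ∈ Set.Icc (-1 : ℝ) 1, psi n α ≤ ENNReal.ofReal (2 * Real.pi)) ∧
    -- the covariance representation
    (∀ f g : Sph n → ℝ, IsC1 f → IsC1 g →
      Integrable (fun p : Sph n × Sph n =>
        ⟪sphericalGradient f p.1, sphericalGradient g p.2⟫) (nu n) ∧
      cov[f, g; sigma n] =
        ∫ p : Sph n × Sph n, ⟪sphericalGradient f p.1, sphericalGradient g p.2⟫ ∂(nu n)) ∧
    -- `ν_n = c_n μ_n`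
    ∃ (c : ℝ) (μ : Measure (Sph n × Sph n)),
      0 < c ∧ IsProbabilityMeasure μ ∧ nu n = ENNReal.ofReal c • μ ∧
      μ.map Prod.fst = sigma n ∧ μ.map Prod.snd = sigma n ∧
      (3 ≤ n → 1 / ((n : ℝ) - 1) < c ∧ c < 1 / ((n : ℝ) - 2)) ∧
      (n = 2 → c < Real.pi) := by
  have hn1 : 1 ≤ n := by omega
  have h0 := mass_ne_zero hn1
  have ht := mass_ne_top hn
  refine ⟨fun α _ => psi_pos hn1 α, fun α hα => psi_lt_top hα.2, ?_, fun f g hf hg => ⟨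
    integrable_inner_sphericalGradient hn hf hg, ?_⟩, (mass n).toReal, (mass n)⁻¹ • nu n,
    ENNReal.toReal_pos h0 ht, ⟨?_⟩, ?_, ?_, ?_, fun h3 => ?_, ?_⟩
  · rintro rfl α hα
    exact psi_two_le hα
  · rw [covariance_sigma hn1 (continuous_of_isC1 hf) (continuous_of_isC1 hg),
      integral_mul_sub_eq_integral_nu hn hf hg]
  · rw [Measure.smul_apply, smul_eq_mul]
    exact ENNReal.inv_mul_cancel h0 ht
  · rw [ENNReal.ofReal_toReal ht, smul_smul, ENNReal.mul_inv_cancel h0 ht, one_smul]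
  · rw [Measure.map_smul, map_fst_nu hn1, smul_smul, ENNReal.inv_mul_cancel h0 ht, one_smul]
  · rw [Measure.map_smul, map_snd_nu hn1, smul_smul, ENNReal.inv_mul_cancel h0 ht, one_smul]
  -- From `(n - 2)c + I = 1` with `0 < I < c` follows `(n - 2)c < 1 < (n - 1)c`; the divisors are
  -- positive as `n ≥ 3`.
  · have h4 := mass_mul_add_integral hn
    have h5 := integral_inner_sq_pos hn
    have h6 := integral_inner_sq_lt hn
    have h7 : (3 : ℝ) ≤ n := by exact_mod_cast h3
    constructor
    · rw [div_lt_iff₀ (by linarith)]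
      linarith
    · rw [lt_div_iff₀ (by linarith)]
      linarith
  · rintro rfl
    exact mass_two_lt
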